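/- **Theorem (Testing Against Independence).** Let $\mathcal X,\mathcal Y_1,\mathcal Y_2$ be finite alphabets and let $P=P_{XY_1Y_2}$ be a probability mass function (pmf) on $\mathcal X\times\mathcal Y_1\times\mathcal Y_2$ with $P_{Y_1Y_2}=P_{Y_1}P_{Y_2}$, i.e. $P_{XY_1Y_2}=P_{X|Y_1Y_2}P_{Y_1}P_{Y_2}$. Put $\bar P_{XY_1Y_2}=P_XP_{Y_1}P_{Y_2}$. Under hypothesis $\mathcal H=0$ the triples $(X_t,Y_{1,t},Y_{2,t})_{t=1}^n$ are i.i.d. $P$; under $\mathcal H=1$ they are i.i.d. $\bar P$. For blocklength $n$, a code consists of sizes $W_{1,n},W_{2,n}$ and functions $\phi_{1,n}:\mathcal X^n\to\{0,\dots,W_{1,n}-1\}$, $\phi_{2,n}:\{0,\dots,W_{1,n}-1\}\times\mathcal Y_1^n\to\{0,\dots,W_{2,n}-1\}$, $\psi_{1,n}:\{0,\dots,W_{1,n}-1\}\times\mathcal Y_1^n\to\{0,1\}$ and $\psi_{2,n}:\{0,\dots,W_{1,n}-1\}\times\{0,\dots,W_{2,n}-1\}\times\mathcal Y_2^n\to\{0,1\}$.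 With $M_1=\phi_{1,n}(X^n)$ and $M_2=\phi_{2,n}(M_1,Y_1^n)$, Detector 1 decides $\hat{\mathcal H}_1=\psi_{1,n}(M_1,Y_1^n)$ and Detector 2 decides $\hat{\mathcal H}_2=\psi_{2,n}(M_1,M_2,Y_2^n)$. Let (coherent detection) $\alpha_{i,n}=\Pr\{\hat{\mathcal H}_i=1\mid\mathcal H=0\}$ and $\beta_{i,n}=\Pr\{\hat{\mathcal H}_i=0\mid\mathcal H=1\}$ for $i=1,2$. A pair $(\theta_1,\theta_2)$ with $\theta_1,\theta_2\ge 0$ is achievable for rates $(R_1,R_2)$ if there is a sequence of codes, one for each $n$, with $$\varlimsup_{n\to\infty}\alpha_{i,n}\le 0,\qquad \theta_i\le\varliminf_{n\to\infty}-\tfrac1n\log\beta_{i,n},\qquad \varlimsup_{n\to\infty}\tfrac1n\log W_{i,n}\le R_i\qquad(i=1,2),$$ where $-\log 0=+\infty$. The error-exponents region $\mathcal E(R_1,R_2)$ is the closure of the set of achievable pairs. Then, for every $R_1>0$, $\mathcal E(R_1,0)$ is exactly the set of all pairs $(\theta_1,\theta_2)$ with $\theta_1,\theta_2\ge0$ for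 which there exists a random variable $U$ with a finite alphabet, jointly distributed with $(X,Y_1,Y_2)\sim P$, such that $U - X - (Y_1,Y_2)$ is a Markov chain, $I(U;X)\le R_1$, and $$\theta_1\le I(U;Y_1),\qquad \theta_2\le I(U;Y_1)+I(U;Y_2).$$ (All logarithms and mutual informations are taken to the same base.) -/

import Mathlib

open Filter Topology

namespace HypTest

/-! ### Finite probability: marginals, mutual information, Markov chains

A probability mass function (pmf) on a finite alphabet `A` is an element of `stdSimplex ℝ A`. -/

section Pmf

variable {A B C D : Type*} [Fintype A] [Fintype B] [Fintype C] [Fintype D]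

/-- Marginal of the first component of a pair. -/
def margFst (p : A × B → ℝ) (a : A) : ℝ := ∑ b, p (a, b)

/-- Marginal of the second component of a pair. -/
def margSnd (p : A × B → ℝ) (b : B) : ℝ := ∑ a, p (a, b)

/-- Mutual information (in nats) of a pair with joint pmf `p`. Terms with `p (a, b) = 0` contribute
zero; if `p (a, b) > 0` then both marginals are positive at `a` and `b`. -/
noncomputable def mutualInfo (p : A × B → ℝ) : ℝ :=
  ∑ a, ∑ b, p (a, b) * Real.log (p (a, b) / (margFst p a * margSnd p b))

/-- Joint marginal of the first and second components of a triple. -/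
def margFstMid (p : A × B × C → ℝ) (ab : A × B) : ℝ := ∑ c, p (ab.1, ab.2, c)

/-- The Markov chain `A - B - C` under the joint pmf `p`: `p(a,b,c) p(b) = p(a,b) p(b,c)`. -/
def IsMarkov (p : A × B × C → ℝ) : Prop :=
  ∀ a b c, p (a, b, c) * margFst (margSnd p) b = margFstMid p (a, b) * margSnd p (b, c)

/-- Joint marginal of the first and third components of a quadruple. -/
def margFstThird (p : A × B × C × D → ℝ) (ac : A × C) : ℝ := ∑ b, ∑ d, p (ac.1, b, ac.2, d)

/-- Joint marginal of the first and fourth components of a quadruple. -/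
def margFstFourth (p : A × B × C × D → ℝ) (ad : A × D) : ℝ := ∑ b, ∑ c, p (ad.1, b, c, ad.2)

end Pmf

/-! ### The two-detector hypothesis testing problem -/

/-- Encoding and decision functions for blocklength `n`, with message alphabets of sizes `W₁` and
`W₂`: the sensor sends `M₁ = enc₁ (Xⁿ)` to both detectors, Detector 1 sends
`M₂ = enc₂ (M₁, Y₁ⁿ)` to Detector 2, and the detectors decide through `dec₁` and `dec₂`. -/
structure Code (X Y₁ Y₂ : Type*) (n : ℕ) where
  W₁ : ℕ
  W₂ : ℕ
  enc₁ : (Fin n → X) → Fin W₁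
  enc₂ : Fin W₁ → (Fin n → Y₁) → Fin W₂
  dec₁ : Fin W₁ → (Fin n → Y₁) → Fin 2
  dec₂ : Fin W₁ → Fin W₂ → (Fin n → Y₂) → Fin 2

section Region

variable {X Y₁ Y₂ : Type*} {n : ℕ}

/-- Decision of Detector 1 when the source sequences `(Xⁿ, Y₁ⁿ, Y₂ⁿ)` are `s`. -/
def Code.guess₁ (c : Code X Y₁ Y₂ n) (s : Fin n → X × Y₁ × Y₂) : Fin 2 :=
  c.dec₁ (c.enc₁ fun t => (s t).1) (fun t => (s t).2.1)

/-- Decision of Detector 2 when the source sequences `(Xⁿ, Y₁ⁿ, Y₂ⁿ)` are `s`. -/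
def Code.guess₂ (c : Code X Y₁ Y₂ n) (s : Fin n → X × Y₁ × Y₂) : Fin 2 :=
  c.dec₂ (c.enc₁ fun t => (s t).1)
    (c.enc₂ (c.enc₁ fun t => (s t).1) (fun t => (s t).2.1))
    (fun t => (s t).2.2)

/-- Probability that `guess` takes the value `h` when its input is i.i.d. with pmf `p`. -/
def probGuess {A : Type*} [Fintype A] (p : A → ℝ) (guess : (Fin n → A) → Fin 2) (h : Fin 2) : ℝ :=
  ∑ s : Fin n → A with guess s = h, ∏ t, p (s t)

variable [Fintype X] [Fintype Y₁] [Fintype Y₂]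

/-- `Pr{Ĥ₁ = h̄₁ | H = h₁}`, where `h₁ = h̄₁ + 1` modulo 2 and `law h` is the single-letter pmf
under hypothesis `h`. -/
def Code.alpha₁ (c : Code X Y₁ Y₂ n) (law : Fin 2 → X × Y₁ × Y₂ → ℝ) (hbar₁ : Fin 2) : ℝ :=
  probGuess (law (hbar₁ + 1)) c.guess₁ hbar₁

/-- `Pr{Ĥ₁ = h₁ | H = h̄₁}`, where `h₁ = h̄₁ + 1` modulo 2. -/
def Code.beta₁ (c : Code X Y₁ Y₂ n) (law : Fin 2 → X × Y₁ × Y₂ → ℝ) (hbar₁ : Fin 2) : ℝ :=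
  probGuess (law hbar₁) c.guess₁ (hbar₁ + 1)

/-- `Pr{Ĥ₂ = 1 | H = 0}`. -/
def Code.alpha₂ (c : Code X Y₁ Y₂ n) (law : Fin 2 → X × Y₁ × Y₂ → ℝ) : ℝ :=
  probGuess (law 0) c.guess₂ 1

/-- `Pr{Ĥ₂ = 0 | H = 1}`. -/
def Code.beta₂ (c : Code X Y₁ Y₂ n) (law : Fin 2 → X × Y₁ × Y₂ → ℝ) : ℝ :=
  probGuess (law 1) c.guess₂ 0

/-- `liminf_n -(1/n) log (β n)` in the extended reals, with `log 0 = -∞`. -/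
noncomputable def errorExponent (β : ℕ → ℝ) : EReal :=
  liminf (fun n : ℕ => -((((n : ℝ)⁻¹ : ℝ) : EReal) * ENNReal.log (ENNReal.ofReal (β n)))) atTop

/-- `limsup_n (1/n) log (W n)` in the extended reals. -/
noncomputable def asympRate (W : ℕ → ℕ) : EReal :=
  limsup (fun n : ℕ => (((n : ℝ)⁻¹ * Real.log (W n) : ℝ) : EReal)) atTop

/-- Achievability of the (nonnegative) error-exponents pair `θ` under the rates `R₁`, `R₂`. -/
def Achievable (law : Fin 2 → X × Y₁ × Y₂ → ℝ) (hbar₁ : Fin 2) (R₁ R₂ : ℝ) (θ : ℝ × ℝ) : Prop :=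
  0 ≤ θ.1 ∧ 0 ≤ θ.2 ∧ ∃ c : ∀ n : ℕ, Code X Y₁ Y₂ n,
    limsup (fun n => (((c n).alpha₁ law hbar₁ : ℝ) : EReal)) atTop ≤ 0 ∧
    limsup (fun n => (((c n).alpha₂ law : ℝ) : EReal)) atTop ≤ 0 ∧
    (θ.1 : EReal) ≤ errorExponent (fun n => (c n).beta₁ law hbar₁) ∧
    (θ.2 : EReal) ≤ errorExponent (fun n => (c n).beta₂ law) ∧
    asympRate (fun n => (c n).W₁) ≤ (R₁ : EReal) ∧
    asympRate (fun n => (c n).W₂) ≤ (R₂ : EReal)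

/-- The error-exponents region `E(R₁, R₂)`: the closure of the set of achievable pairs. -/
def exponentsRegion (law : Fin 2 → X × Y₁ × Y₂ → ℝ) (hbar₁ : Fin 2) (R₁ R₂ : ℝ) : Set (ℝ × ℝ) :=
  closure {θ | Achievable law hbar₁ R₁ R₂ θ}

end Region

end HypTest

/-!
The two inclusions rest on a description of the information triples `(I(U;X), I(U;Y₁), I(U;Y₂))` of
all finite auxiliary variables `U` with `U - X - (Y₁, Y₂)` Markov. Such a triple is an average, over
the values of `U`, of the entropy drops caused by replacing the law of `X` by its conditional law
given `U`, so the set `infoSet` of triples is the section at the law of `X` of the convex hull of the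
graph of a continuous function on a simplex. Hence it is convex, contains `0` and, by Carathéodory's
theorem, is compact: no bound on the alphabet of `U` has to be chosen.

Converse. Data processing for relative entropy bounds `(1 - α) (-log β)`, up to `log 2`, by the
relative entropy between the two laws of what a detector observes. For Detector 1 this is
`I(M₁; Y₁ⁿ)`. For Detector 2 it splits into the relative entropy between the laws of `(M₁, M₂)`,
which is at most `I(M₁; Y₁ⁿ)` since `M₂` is a function of `(M₁, Y₁ⁿ)`, and `I(M₁, M₂; Y₂ⁿ)`, which is
at most `I(M₁; Y₂ⁿ) + log W₂` (`Code.kl_obs₁`, `Code.kl_obs₂_le`); at zero rate `log W₂ = o(n)`. The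
triple `(I(M₁; Xⁿ), I(M₁; Y₁ⁿ), I(M₁; Y₂ⁿ))` is then single-letterized by induction on the
blocklength, moving the first source letter into the message at each step
(`exists_mem_infoSet_of_block`), and compactness of `infoSet` passes to the limit.

Achievability. A codebook of about `exp (n R₁)` words quantizes the source block. A random choice of
words shows that for most source blocks some codeword has likelihood ratio with the block at most
`exp (n (I(U;X) + ε))` and, conditionally on the block, is very likely to be typical with both
outputs (`exists_covering_channel`); asking for the conditional probability takes the place of a
Markov lemma. Each detector compares the likelihood ratio of the codeword and its own observation
with a threshold, Detector 1 forwards its one-bit decision, and Detector 2 accepts if both tests do.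
Under independence the tests succeed with probabilities at most `exp (-n (I(U;Y₁) - ε))` and
`exp (-n (I(U;Y₂) - ε))`, independently given the codeword, so the exponents add for Detector 2
(`exists_code`). Scaling a triple towards `0` turns `I(U;X) ≤ R₁` into a strict inequality, and the
closure in the definition of the region absorbs the loss.
-/

namespace HypTest

/-! ### Compactness of convex hulls -/

/-- In finite dimension the convex hull of a compact set is compact: by Carathéodory's theorem it is
the continuous image of a product of a simplex with finitely many copies of the set. -/
theorem isCompact_convexHull_of_isCompact {E : Type*} [NormedAddCommGroup E] [NormedSpace ℝ E]
    [FiniteDimensional ℝ E] {s : Set E} (hs : IsCompact s) : IsCompact (convexHull ℝ s) := by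
  rcases s.eq_empty_or_nonempty with rfl | ⟨e₀, he₀⟩
  · simp
  set d := Module.finrank ℝ E + 1 with hd
  set g : (Fin d → ℝ) × (Fin d → E) → E := fun wz => ∑ i, wz.1 i • wz.2 i with hg
  have hgc : Continuous g := by fun_prop
  have hC : IsCompact (stdSimplex ℝ (Fin d) ×ˢ Set.univ.pi fun _ : Fin d => s) :=
    (isCompact_stdSimplex ℝ (Fin d)).prod (isCompact_univ_pi fun _ => hs)
  suffices convexHull ℝ s = g '' (stdSimplex ℝ (Fin d) ×ˢ Set.univ.pi fun _ : Fin d => s) by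
    rw [this]
    exact hC.image hgc
  apply Set.Subset.antisymm
  · intro x hx
    obtain ⟨ι, _, z, w, hz, hai, hw, hw1, hsum⟩ := eq_pos_convex_span_of_mem_convexHull hx
    have hcard : Fintype.card ι ≤ Fintype.card (Fin d) := by
      rw [Fintype.card_fin]
      exact hai.card_le_finrank_succ.trans (by
        rw [hd]
        exact Nat.add_le_add_right (Submodule.finrank_le _) 1)
    obtain ⟨f⟩ := Function.Embedding.nonempty_of_card_le hcard
    have hf := f.injective
    refine ⟨(Function.extend f w 0, Function.extend f z fun _ => e₀), ⟨⟨fun i => ?_, ?_⟩, ?_⟩, ?_⟩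
    · by_cases h : ∃ a, f a = i
      · obtain ⟨a, rfl⟩ := h
        exact (hw a).le.trans_eq (hf.extend_apply _ _ _).symm
      · dsimp only
        rw [Function.extend_apply' _ _ _ h]
        exact le_rfl
    · rw [← hw1]
      symm
      refine Fintype.sum_of_injective f hf _ _ (fun i hi => ?_) fun i => ?_
      · dsimp only
        rw [Function.extend_apply' _ _ _ (by simpa using hi)]
        rfl
      · dsimp only
        rw [hf.extend_apply]
    · intro i _
      by_cases h : ∃ a, f a = i
      · obtain ⟨a, rfl⟩ := h
        dsimp only
        rw [hf.extend_apply]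
        exact hz ⟨a, rfl⟩
      · dsimp only
        rw [Function.extend_apply' _ _ _ h]
        exact he₀
    · rw [← hsum]
      symm
      refine Fintype.sum_of_injective f hf _ _ (fun i hi => ?_) fun i => ?_
      · dsimp only
        rw [Function.extend_apply' _ _ _ (by simpa using hi)]
        simp
      · dsimp only
        rw [hf.extend_apply, hf.extend_apply]
  · rintro x ⟨⟨w, z⟩, ⟨⟨hw, hw1⟩, hz⟩, rfl⟩
    exact mem_convexHull_iff_exists_fintype.2
      ⟨Fin d, inferInstance, w, z, hw, hw1, fun i => hz i trivial, rfl⟩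

/-! ### Entropy of finite distributions -/

theorem margFst_nonneg {A B : Type*} [Fintype B] {p : A × B → ℝ} (hp : ∀ x, 0 ≤ p x) (a : A) : 0 ≤ margFst p a :=
  Finset.sum_nonneg fun _ _ => hp _

theorem margSnd_nonneg {A B : Type*} [Fintype A] {p : A × B → ℝ} (hp : ∀ x, 0 ≤ p x) (b : B) : 0 ≤ margSnd p b :=
  Finset.sum_nonneg fun _ _ => hp _

theorem eq_zero_of_margFst_eq_zero {A B : Type*} [Fintype B] {p : A × B → ℝ} (hp : ∀ x, 0 ≤ p x) {a : A}
    (h : margFst p a = 0) (b : B) : p (a, b) = 0 :=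
  (Finset.sum_eq_zero_iff_of_nonneg fun b _ => hp (a, b)).1 h b (Finset.mem_univ b)

theorem eq_zero_of_margSnd_eq_zero {A B : Type*} [Fintype A] {p : A × B → ℝ} (hp : ∀ x, 0 ≤ p x) {b : B}
    (h : margSnd p b = 0) (a : A) : p (a, b) = 0 :=
  (Finset.sum_eq_zero_iff_of_nonneg fun a _ => hp (a, b)).1 h a (Finset.mem_univ a)

section Entropy

variable {A B C : Type*} [Fintype A] [Fintype B] [Fintype C]

/-- Shannon entropy, in nats. -/
noncomputable def ent (p : A → ℝ) : ℝ := ∑ a, Real.negMulLog (p a)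

theorem ent_comp_equiv (e : A ≃ B) (p : B → ℝ) : ent (p ∘ e) = ent p :=
  Equiv.sum_comp e fun b => Real.negMulLog (p b)

/-- Joint law of a pair whose first component has law `w` and whose second component is drawn from
the first through the kernel `k`. -/
def compProd {A B : Type*} (w : A → ℝ) (k : A → B → ℝ) (ab : A × B) : ℝ := w ab.1 * k ab.1 ab.2

/-- Chain rule for entropy. -/
theorem ent_compProd (w : A → ℝ) (k : A → B → ℝ) (hk : ∀ a, ∑ b, k a b = 1) :
    ent (compProd w k) = ent w + ∑ a, w a * ent (k a) := by
  simp only [ent, compProd, Fintype.sum_prod_type, Real.negMulLog_mul, Finset.sum_add_distrib,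
    ← Finset.sum_mul, ← Finset.mul_sum, hk, one_mul]

theorem ent_prod (p : A → ℝ) (q : B → ℝ) (hp : ∑ a, p a = 1) (hq : ∑ b, q b = 1) :
    ent (compProd p fun _ => q) = ent p + ent q := by
  rw [ent_compProd p (fun _ => q) fun _ => hq, ← Finset.sum_mul, hp, one_mul]

theorem sum_margFst (p : A × B → ℝ) : ∑ a, margFst p a = ∑ x, p x := by
  simp only [margFst, Fintype.sum_prod_type]

theorem sum_margSnd (p : A × B → ℝ) : ∑ b, margSnd p b = ∑ x, p x := by
  simp only [margSnd, Fintype.sum_prod_type]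
  exact Finset.sum_comm

theorem mutualInfo_eq_ent {p : A × B → ℝ} (hp : ∀ x, 0 ≤ p x) :
    mutualInfo p = ent (margFst p) + ent (margSnd p) - ent p := by
  have key : ∀ a b, p (a, b) * Real.log (p (a, b) / (margFst p a * margSnd p b))
      = p (a, b) * Real.log (p (a, b)) - p (a, b) * Real.log (margFst p a)
        - p (a, b) * Real.log (margSnd p b) := by
    intro a b
    by_cases h : p (a, b) = 0
    · simp [h]
    · have h1 : margFst p a ≠ 0 := fun h0 => h (eq_zero_of_margFst_eq_zero hp h0 b)
      have h2 : margSnd p b ≠ 0 := fun h0 => h (eq_zero_of_margSnd_eq_zero hp h0 a)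
      rw [Real.log_div h (mul_ne_zero h1 h2), Real.log_mul h1 h2]
      ring
  have e1 : ∑ a, ∑ b, p (a, b) * Real.log (margFst p a) = -ent (margFst p) := by
    simp only [ent, Real.negMulLog, ← Finset.sum_mul, neg_mul, Finset.sum_neg_distrib, neg_neg]
    rfl
  have e2 : ∑ a, ∑ b, p (a, b) * Real.log (margSnd p b) = -ent (margSnd p) := by
    rw [Finset.sum_comm]
    simp only [ent, Real.negMulLog, ← Finset.sum_mul, neg_mul, Finset.sum_neg_distrib, neg_neg]
    rfl
  have e3 : ∑ a, ∑ b, p (a, b) * Real.log (p (a, b)) = -ent p := by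
    simp only [ent, Real.negMulLog, neg_mul, Finset.sum_neg_distrib, neg_neg,
      Fintype.sum_prod_type]
  simp only [mutualInfo, key, Finset.sum_sub_distrib, e1, e2, e3]
  ring

/-! ### Relative entropy -/

/-- Relative entropy, in nats. It is used only for `p` absolutely continuous with respect to
`r`. -/
noncomputable def kl (p r : A → ℝ) : ℝ := ∑ a, p a * Real.log (p a / r a)

/-- The log-sum inequality. -/
theorem sum_mul_log_div_le {A : Type*} (s : Finset A) {p r : A → ℝ} (hp : ∀ a, 0 ≤ p a) (hr : ∀ a, 0 ≤ r a)
    (hpr : ∀ a, r a = 0 → p a = 0) :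
    (∑ a ∈ s, p a) * Real.log ((∑ a ∈ s, p a) / ∑ a ∈ s, r a)
      ≤ ∑ a ∈ s, p a * Real.log (p a / r a) := by
  set Sp := ∑ a ∈ s, p a with hSp
  set Sr := ∑ a ∈ s, r a with hSr
  have hSp0 : 0 ≤ Sp := Finset.sum_nonneg fun a _ => hp a
  rcases hSp0.eq_or_lt with h0 | hpos
  · have hz : ∀ a ∈ s, p a = 0 := (Finset.sum_eq_zero_iff_of_nonneg fun a _ => hp a).1 h0.symm
    rw [← h0, zero_mul, Finset.sum_eq_zero fun a ha => by rw [hz a ha, zero_mul]]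
  have hrpos : 0 < Sr := by
    refine (Finset.sum_nonneg fun a _ => hr a).lt_of_ne fun h => hpos.ne' ?_
    have hz := (Finset.sum_eq_zero_iff_of_nonneg fun a _ => hr a).1 h.symm
    exact Finset.sum_eq_zero fun a ha => hpr a (hz a ha)
  set c := Sp / Sr with hc
  have hcpos : 0 < c := div_pos hpos hrpos
  -- the tangent line bound `log x ≥ 1 - 1 / x` at `x = p a / (c * r a)`
  have key : ∀ a ∈ s, p a * Real.log c + (p a - c * r a) ≤ p a * Real.log (p a / r a) := by
    intro a _
    rcases (hp a).eq_or_lt with h | h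
    · rw [← h]
      nlinarith [mul_nonneg hcpos.le (hr a)]
    · have hra : 0 < r a := (hr a).lt_of_ne fun h' => h.ne' (hpr a h'.symm)
      have h1 := Real.one_sub_inv_le_log_of_pos (div_pos (div_pos h hra) hcpos)
      rw [Real.log_div (div_pos h hra).ne' hcpos.ne'] at h1
      have h2 := mul_le_mul_of_nonneg_left h1 h.le
      have h3 : p a * (1 - (p a / r a / c)⁻¹) = p a - c * r a := by
        field_simp
      rw [h3] at h2
      linarith
  calc Sp * Real.log c = ∑ a ∈ s, (p a * Real.log c + (p a - c * r a)) := by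
        rw [Finset.sum_add_distrib, Finset.sum_sub_distrib, ← Finset.sum_mul, ← Finset.mul_sum,
          ← hSp, ← hSr, hc, div_mul_cancel₀ _ hrpos.ne', sub_self, add_zero]
    _ ≤ _ := Finset.sum_le_sum key

open Classical in
/-- Image of the weights `p` under the map `f`. -/
noncomputable def push (f : A → B) (p : A → ℝ) (b : B) : ℝ := ∑ a with f a = b, p a

theorem push_nonneg {A B : Type*} [Fintype A] (f : A → B) {p : A → ℝ} (hp : ∀ a, 0 ≤ p a) (b : B) : 0 ≤ push f p b :=
  Finset.sum_nonneg fun a _ => hp a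

/-- Data processing for relative entropy. -/
theorem kl_push_le (f : A → B) {p r : A → ℝ} (hp : ∀ a, 0 ≤ p a) (hr : ∀ a, 0 ≤ r a)
    (hpr : ∀ a, r a = 0 → p a = 0) : kl (push f p) (push f r) ≤ kl p r := by
  classical
  calc kl (push f p) (push f r)
      ≤ ∑ b, ∑ a with f a = b, p a * Real.log (p a / r a) :=
        Finset.sum_le_sum fun b _ => by
          have := sum_mul_log_div_le (Finset.univ.filter fun a => f a = b) hp hr hpr
          unfold push
          convert this using 3
    _ = kl p r := Finset.sum_fiberwise _ f _

theorem kl_nonneg_of_sum_eq {p r : A → ℝ} (hp : ∀ a, 0 ≤ p a) (hr : ∀ a, 0 ≤ r a)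
    (hpr : ∀ a, r a = 0 → p a = 0) (h : ∑ a, p a = ∑ a, r a) : 0 ≤ kl p r := by
  refine le_trans ?_ (sum_mul_log_div_le Finset.univ hp hr hpr)
  rw [← h]
  by_cases h0 : ∑ a, p a = 0
  · simp [h0]
  · simp [div_self h0]

/-- Strong subadditivity of entropy: conditioning on more reduces entropy. -/
theorem ent_submodular {p : A × B × C → ℝ} (hp : ∀ x, 0 ≤ p x) :
    ent p + ent (margSnd (margSnd p))
      ≤ ent (fun ac : A × C => ∑ b, p (ac.1, b, ac.2)) + ent (margSnd p) := by
  set pAC : A × C → ℝ := fun ac => ∑ b, p (ac.1, b, ac.2) with hAC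
  set pBC := margSnd p with hBC
  set pC := margSnd pBC with hC
  have hAC0 : ∀ x, 0 ≤ pAC x := fun x => Finset.sum_nonneg fun b _ => hp _
  have hBC0 : ∀ x, 0 ≤ pBC x := margSnd_nonneg hp
  have hC0 : ∀ x, 0 ≤ pC x := margSnd_nonneg hBC0
  have zAC : ∀ a b c, pAC (a, c) = 0 → p (a, b, c) = 0 := fun a b c h =>
    (Finset.sum_eq_zero_iff_of_nonneg fun b _ => hp (a, b, c)).1 h b (Finset.mem_univ b)
  have zBC : ∀ a b c, pBC (b, c) = 0 → p (a, b, c) = 0 := fun a b c h =>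
    eq_zero_of_margSnd_eq_zero hp h a
  have zC : ∀ a b c, pC c = 0 → p (a, b, c) = 0 := fun a b c h =>
    zBC a b c (eq_zero_of_margSnd_eq_zero hBC0 h b)
  have sAC : ∀ c, ∑ a, pAC (a, c) = pC c := fun c => by
    simp only [hAC, hC, hBC, margSnd]
    exact Finset.sum_comm
  obtain ⟨r, hr⟩ : ∃ r : A × B × C → ℝ, r = fun x => pAC (x.1, x.2.2) * pBC x.2 / pC x.2.2 :=
    ⟨_, rfl⟩
  have hrs : ∑ x, p x = ∑ x, r x := by
    rw [← sum_margSnd p, Fintype.sum_prod_type r, Finset.sum_comm]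
    refine Finset.sum_congr rfl fun bc _ => ?_
    simp only [hr, ← Finset.sum_div, ← Finset.sum_mul, sAC]
    by_cases h : pC bc.2 = 0
    · rw [h, div_zero]
      exact eq_zero_of_margSnd_eq_zero hBC0 h bc.1
    · rw [mul_div_assoc, mul_div_cancel₀ _ h]
  have hk := kl_nonneg_of_sum_eq hp
    (fun x => by rw [hr]; exact div_nonneg (mul_nonneg (hAC0 _) (hBC0 _)) (hC0 _) : ∀ x, 0 ≤ r x)
    (fun x h => by
      obtain ⟨a, b, c⟩ := x
      simp only [hr, div_eq_zero_iff, mul_eq_zero] at h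
      rcases h with (h | h) | h
      exacts [zAC a b c h, zBC a b c h, zC a b c h]) hrs
  have key : ∀ a b c, p (a, b, c) * Real.log (p (a, b, c) / r (a, b, c))
      = p (a, b, c) * Real.log (p (a, b, c)) - p (a, b, c) * Real.log (pAC (a, c))
        - p (a, b, c) * Real.log (pBC (b, c)) + p (a, b, c) * Real.log (pC c) := by
    intro a b c
    by_cases h : p (a, b, c) = 0
    · simp [h]
    · have h1 : pAC (a, c) ≠ 0 := fun h0 => h (zAC a b c h0)
      have h2 : pBC (b, c) ≠ 0 := fun h0 => h (zBC a b c h0)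
      have h3 : pC c ≠ 0 := fun h0 => h (zC a b c h0)
      simp only [hr]
      rw [Real.log_div h (div_ne_zero (mul_ne_zero h1 h2) h3), Real.log_div (mul_ne_zero h1 h2) h3,
        Real.log_mul h1 h2]
      ring
  have e0 : ∑ a, ∑ b, ∑ c, p (a, b, c) * Real.log (p (a, b, c)) = -ent p := by
    simp only [ent, Real.negMulLog, neg_mul, Finset.sum_neg_distrib, neg_neg,
      Fintype.sum_prod_type]
  have e1 : ∑ a, ∑ b, ∑ c, p (a, b, c) * Real.log (pAC (a, c)) = -ent pAC := by
    simp only [ent, Real.negMulLog, neg_mul, Finset.sum_neg_distrib, neg_neg,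
      Fintype.sum_prod_type]
    refine Finset.sum_congr rfl fun a _ => ?_
    rw [Finset.sum_comm]
    exact Finset.sum_congr rfl fun c _ => (Finset.sum_mul ..).symm
  have e2 : ∑ a, ∑ b, ∑ c, p (a, b, c) * Real.log (pBC (b, c)) = -ent pBC := by
    simp only [ent, Real.negMulLog, neg_mul, Finset.sum_neg_distrib, neg_neg,
      Fintype.sum_prod_type]
    rw [Finset.sum_comm]
    refine Finset.sum_congr rfl fun b _ => ?_
    rw [Finset.sum_comm]
    exact Finset.sum_congr rfl fun c _ => (Finset.sum_mul ..).symm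
  have e3 : ∑ a, ∑ b, ∑ c, p (a, b, c) * Real.log (pC c) = -ent pC := by
    simp only [ent, Real.negMulLog, neg_mul, Finset.sum_neg_distrib, neg_neg]
    rw [Finset.sum_comm]
    calc _ = ∑ b, ∑ c, pBC (b, c) * Real.log (pC c) := by
          refine Finset.sum_congr rfl fun b _ => ?_
          rw [Finset.sum_comm]
          exact Finset.sum_congr rfl fun c _ => (Finset.sum_mul ..).symm
      _ = _ := by
          rw [Finset.sum_comm]
          exact Finset.sum_congr rfl fun c _ => (Finset.sum_mul ..).symm
  simp only [kl, Fintype.sum_prod_type, key, Finset.sum_add_distrib, Finset.sum_sub_distrib,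
    e0, e1, e2, e3] at hk
  linarith

end Entropy

/-! ### Channels and the set of single-letter information triples -/

section Channel

variable {M X Y Z : Type*} [Fintype M] [Fintype X] [Fintype Y] [Fintype Z]

theorem compProd_nonneg {A B : Type*} {w : A → ℝ} {k : A → B → ℝ} (hw : ∀ a, 0 ≤ w a)
    (hk : ∀ a b, 0 ≤ k a b) (ab : A × B) : 0 ≤ compProd w k ab :=
  mul_nonneg (hw _) (hk _ _)

theorem margFst_compProd {A B : Type*} [Fintype B] {w : A → ℝ} {k : A → B → ℝ}
    (hk : ∀ a, ∑ b, k a b = 1) : margFst (compProd w k) = w := by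
  funext a
  simp only [margFst, compProd, ← Finset.mul_sum, hk, mul_one]

theorem compProd_mem_stdSimplex {w : M → ℝ} {k : M → X → ℝ} (hw : w ∈ stdSimplex ℝ M)
    (hk : ∀ m, k m ∈ stdSimplex ℝ X) : compProd w k ∈ stdSimplex ℝ (M × X) := by
  refine ⟨compProd_nonneg hw.1 fun m => (hk m).1, ?_⟩
  rw [← sum_margFst, margFst_compProd fun m => (hk m).2, hw.2]

/-- Disintegration of a joint law; `d` serves as the conditional law at points of probability
zero. -/
theorem exists_eq_compProd {M X : Type*} [Fintype X] {v : M × X → ℝ} (hv : ∀ a, 0 ≤ v a) {d : X → ℝ}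
    (hd : d ∈ stdSimplex ℝ X) :
    ∃ k : M → X → ℝ, (∀ m, k m ∈ stdSimplex ℝ X) ∧ v = compProd (margFst v) k := by
  classical
  refine ⟨fun m => if margFst v m = 0 then d else fun x => v (m, x) / margFst v m,
    fun m => ?_, ?_⟩
  · dsimp only
    split_ifs with h
    · exact hd
    · refine ⟨fun x => div_nonneg (hv _) (margFst_nonneg hv m), ?_⟩
      rw [← Finset.sum_div]
      exact div_self h
  · funext ⟨m, x⟩
    simp only [compProd]
    split_ifs with h
    · rw [h, zero_mul, eq_zero_of_margFst_eq_zero hv h x]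
    · exact (mul_div_cancel₀ _ h).symm

/-- Output law of the channel `K` for the input law `p`. -/
def output (K : X → Y → ℝ) (p : X → ℝ) (y : Y) : ℝ := ∑ x, p x * K x y

/-- Joint law of `(M, Y)`, where `(M, X)` has law `v` and `Y` is the output of the channel `K` with
input `X`. -/
def outputSnd (K : X → Y → ℝ) (v : M × X → ℝ) (my : M × Y) : ℝ := ∑ x, v (my.1, x) * K x my.2

theorem output_mem_stdSimplex {K : X → Y → ℝ} (hK : ∀ x, K x ∈ stdSimplex ℝ Y) {p : X → ℝ}
    (hp : p ∈ stdSimplex ℝ X) : output K p ∈ stdSimplex ℝ Y := by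
  refine ⟨fun y => Finset.sum_nonneg fun x _ => mul_nonneg (hp.1 x) ((hK x).1 y), ?_⟩
  simp only [output]
  rw [Finset.sum_comm]
  simp only [← Finset.mul_sum, (hK _).2, mul_one, hp.2]

theorem outputSnd_nonneg {M X Y : Type*} [Fintype X] {K : X → Y → ℝ} (hK : ∀ x y, 0 ≤ K x y)
    {v : M × X → ℝ} (hv : ∀ a, 0 ≤ v a) (my : M × Y) : 0 ≤ outputSnd K v my :=
  Finset.sum_nonneg fun x _ => mul_nonneg (hv _) (hK x _)

theorem margFst_outputSnd {M X Y : Type*} [Fintype X] [Fintype Y] {K : X → Y → ℝ}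
    (hK : ∀ x, ∑ y, K x y = 1) (v : M × X → ℝ) :
    margFst (outputSnd K v) = margFst v := by
  funext m
  simp only [margFst, outputSnd]
  rw [Finset.sum_comm]
  simp only [← Finset.mul_sum, hK, mul_one]

theorem margSnd_outputSnd {M X Y : Type*} [Fintype X] [Fintype M] (K : X → Y → ℝ)
    (v : M × X → ℝ) :
    margSnd (outputSnd K v) = output K (margSnd v) := by
  funext y
  simp only [margSnd, outputSnd, output, Finset.sum_mul]
  exact Finset.sum_comm

theorem outputSnd_compProd {M X Y : Type*} [Fintype X] (K : X → Y → ℝ) (w : M → ℝ)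
    (k : M → X → ℝ) :
    outputSnd K (compProd w k) = compProd w fun m => output K (k m) := by
  funext ⟨m, y⟩
  simp only [outputSnd, compProd, output, Finset.mul_sum, mul_assoc]

variable (P : X → ℝ) (K₁ : X → Y → ℝ) (K₂ : X → Z → ℝ)

/-- Reductions of the entropies of `X`, `Y`, `Z` when the law of `X` changes from `P` to `p`, where
`Y` and `Z` are outputs of channels with input `X`. -/
noncomputable def entDrop (p : X → ℝ) : ℝ × ℝ × ℝ :=
  (ent P - ent p, ent (output K₁ P) - ent (output K₁ p), ent (output K₂ P) - ent (output K₂ p))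

/-- The triple `(I(M;X), I(M;Y), I(M;Z))` when `(M, X)` has law `v` with `X ∼ P` and `Y`, `Z` are
outputs of channels with input `X`. -/
noncomputable def infoTriple (v : M × X → ℝ) : ℝ × ℝ × ℝ :=
  (ent (margFst v) + ent P - ent v,
    ent (margFst v) + ent (output K₁ P) - ent (outputSnd K₁ v),
    ent (margFst v) + ent (output K₂ P) - ent (outputSnd K₂ v))

/-- The set of triples `(I(U;X), I(U;Y), I(U;Z))` over all finite `U` with `U - X - (Y, Z)` Markov,
encoded as the section at `P` of a convex hull in the space of pairs (law of `X`, triple). -/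
def infoSet : Set (ℝ × ℝ × ℝ) :=
  {t | (P, t) ∈ convexHull ℝ ((fun p => (p, entDrop P K₁ K₂ p)) '' stdSimplex ℝ X)}

variable {P K₁ K₂}

theorem infoTriple_compProd {w : M → ℝ} (hw : w ∈ stdSimplex ℝ M) {k : M → X → ℝ}
    (hk : ∀ m, k m ∈ stdSimplex ℝ X) (hK₁ : ∀ x, K₁ x ∈ stdSimplex ℝ Y)
    (hK₂ : ∀ x, K₂ x ∈ stdSimplex ℝ Z) :
    infoTriple P K₁ K₂ (compProd w k) = ∑ m, w m • entDrop P K₁ K₂ (k m) := by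
  have aux : ∀ (c : ℝ) (f : M → ℝ), ∑ m, w m * (c - f m) = c - ∑ m, w m * f m := fun c f => by
    simp only [mul_sub, Finset.sum_sub_distrib, ← Finset.sum_mul, hw.2, one_mul]
  have h0 := ent_compProd w k fun m => (hk m).2
  have h1 := ent_compProd w (fun m => output K₁ (k m))
    fun m => (output_mem_stdSimplex hK₁ (hk m)).2
  have h2 := ent_compProd w (fun m => output K₂ (k m))
    fun m => (output_mem_stdSimplex hK₂ (hk m)).2
  have hm : margFst (compProd w k) = w := margFst_compProd fun m => (hk m).2
  refine Prod.ext ?_ (Prod.ext ?_ ?_)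
  · simp only [infoTriple, entDrop, Prod.fst_sum, Prod.smul_fst, smul_eq_mul, aux, hm, h0]
    ring
  · simp only [infoTriple, entDrop, Prod.fst_sum, Prod.snd_sum, Prod.smul_fst, Prod.smul_snd,
      smul_eq_mul, aux, hm, outputSnd_compProd, h1]
    ring
  · simp only [infoTriple, entDrop, Prod.snd_sum, Prod.smul_snd,
      smul_eq_mul, aux, hm, outputSnd_compProd, h2]
    ring

theorem infoTriple_mem_infoSet (hP : P ∈ stdSimplex ℝ X) (hK₁ : ∀ x, K₁ x ∈ stdSimplex ℝ Y)
    (hK₂ : ∀ x, K₂ x ∈ stdSimplex ℝ Z) {v : M × X → ℝ} (hv : ∀ a, 0 ≤ v a)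
    (hvP : margSnd v = P) : infoTriple P K₁ K₂ v ∈ infoSet P K₁ K₂ := by
  obtain ⟨k, hk, hvk⟩ := exists_eq_compProd hv hP
  have hw : margFst v ∈ stdSimplex ℝ M :=
    ⟨margFst_nonneg hv, by rw [sum_margFst, ← sum_margSnd, hvP, hP.2]⟩
  have hsum : (P, infoTriple P K₁ K₂ v)
      = ∑ m, margFst v m • (k m, entDrop P K₁ K₂ (k m)) := by
    refine Prod.ext ?_ ?_
    · simp only [Prod.fst_sum, Prod.smul_fst]
      funext x
      rw [← hvP, Finset.sum_apply]
      exact Finset.sum_congr rfl fun m _ => congrFun hvk (m, x)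
    · simp only [Prod.snd_sum, Prod.smul_snd]
      rw [← infoTriple_compProd hw hk hK₁ hK₂, ← hvk]
  change (P, infoTriple P K₁ K₂ v) ∈ convexHull ℝ _
  rw [hsum]
  exact (convex_convexHull ℝ _).sum_mem (fun m _ => hw.1 m) hw.2
    fun m _ => subset_convexHull ℝ _ ⟨k m, hk m, rfl⟩

theorem exists_infoTriple_eq (hK₁ : ∀ x, K₁ x ∈ stdSimplex ℝ Y)
    (hK₂ : ∀ x, K₂ x ∈ stdSimplex ℝ Z) {t : ℝ × ℝ × ℝ} (ht : t ∈ infoSet P K₁ K₂) :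
    ∃ (U : Type) (_ : Fintype U) (v : U × X → ℝ), v ∈ stdSimplex ℝ (U × X) ∧ margSnd v = P ∧
      infoTriple P K₁ K₂ v = t := by
  obtain ⟨U, _, w, z, hw, hw1, hz, hsum⟩ := mem_convexHull_iff_exists_fintype.1 ht
  choose k hk hkz using hz
  refine ⟨U, inferInstance, compProd w k, compProd_mem_stdSimplex ⟨hw, hw1⟩ hk, ?_, ?_⟩
  · refine Eq.trans ?_ (congrArg Prod.fst hsum)
    funext x
    simp only [margSnd, compProd, Prod.fst_sum, Prod.smul_fst, ← hkz, Finset.sum_apply,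
      Pi.smul_apply, smul_eq_mul]
  · rw [infoTriple_compProd ⟨hw, hw1⟩ hk hK₁ hK₂]
    refine Eq.trans ?_ (congrArg Prod.snd hsum)
    simp only [Prod.snd_sum, Prod.smul_snd, ← hkz]

theorem convex_infoSet : Convex ℝ (infoSet P K₁ K₂) := by
  intro s hs t ht a b ha hb hab
  have h : (P, a • s + b • t) = a • (P, s) + b • (P, t) := by
    refine Prod.ext ?_ rfl
    change P = a • P + b • P
    rw [← add_smul, hab, one_smul]
  change (P, a • s + b • t) ∈ convexHull ℝ _
  rw [h]
  exact convex_convexHull ℝ _ hs ht ha hb hab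

theorem zero_mem_infoSet (hP : P ∈ stdSimplex ℝ X) : (0 : ℝ × ℝ × ℝ) ∈ infoSet P K₁ K₂ :=
  subset_convexHull ℝ _ ⟨P, hP, by simp [entDrop]⟩

theorem continuous_ent : Continuous (ent : (X → ℝ) → ℝ) :=
  continuous_finsetSum _ fun x _ => Real.continuous_negMulLog.comp (continuous_apply x)

theorem isCompact_infoSet : IsCompact (infoSet P K₁ K₂) := by
  have hc : Continuous fun p => (p, entDrop P K₁ K₂ p) := by
    refine continuous_id.prodMk ((continuous_const.sub continuous_ent).prodMk
      ((continuous_const.sub ?_).prodMk (continuous_const.sub ?_)))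
    · exact continuous_ent.comp
        (continuous_pi fun y => continuous_finsetSum _ fun x _ => (continuous_apply x).mul_const _)
    · exact continuous_ent.comp
        (continuous_pi fun y => continuous_finsetSum _ fun x _ => (continuous_apply x).mul_const _)
  have hcomp := isCompact_convexHull_of_isCompact ((isCompact_stdSimplex ℝ X).image hc)
  have h2 : infoSet P K₁ K₂ = Prod.snd ''
      (convexHull ℝ ((fun p => (p, entDrop P K₁ K₂ p)) '' stdSimplex ℝ X) ∩ {x | x.1 = P}) := by
    ext t
    constructor
    · intro ht
      exact ⟨(P, t), ⟨ht, rfl⟩, rfl⟩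
    · rintro ⟨⟨p, t'⟩, ⟨h, rfl⟩, rfl⟩
      exact h
  rw [h2]
  exact (hcomp.inter_right (isClosed_eq continuous_fst continuous_const)).image continuous_snd

end Channel

/-! ### Memoryless sources and channels -/

section Iid

variable {A B : Type*} [Fintype A] [Fintype B]

/-- Law of `n` independent letters with law `p`. -/
def iid (p : A → ℝ) (n : ℕ) (s : Fin n → A) : ℝ := ∏ t, p (s t)

/-- The `n`-fold memoryless use of the channel `K`. -/
def iidKer (K : A → B → ℝ) (n : ℕ) (x : Fin n → A) (y : Fin n → B) : ℝ := ∏ t, K (x t) (y t)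

theorem iid_nonneg {A : Type*} {p : A → ℝ} (hp : ∀ a, 0 ≤ p a) (n : ℕ) (s : Fin n → A) :
    0 ≤ iid p n s :=
  Finset.prod_nonneg fun _ _ => hp _

theorem iid_cons {A : Type*} (p : A → ℝ) (n : ℕ) (a : A) (s : Fin n → A) :
    iid p (n + 1) (Fin.cons a s) = p a * iid p n s := by
  simp [iid, Fin.prod_univ_succ]

theorem iidKer_cons {A B : Type*} (K : A → B → ℝ) (n : ℕ) (a : A) (x : Fin n → A) (b : B)
    (y : Fin n → B) :
    iidKer K (n + 1) (Fin.cons a x) (Fin.cons b y) = K a b * iidKer K n x y := by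
  simp [iidKer, Fin.prod_univ_succ]

theorem sum_cons {E : Type*} [AddCommMonoid E] (n : ℕ) (F : (Fin (n + 1) → A) → E) :
    ∑ s, F s = ∑ a, ∑ s : Fin n → A, F (Fin.cons a s) := by
  rw [← (Fin.consEquiv fun _ : Fin (n + 1) => A).sum_comp F, Fintype.sum_prod_type]
  rfl

theorem sum_prod_apply (n : ℕ) (f : Fin n → A → ℝ) :
    ∑ s : Fin n → A, ∏ t, f t (s t) = ∏ t, ∑ a, f t a :=
  (Fintype.prod_sum f).symm

theorem iid_mem_stdSimplex {p : A → ℝ} (hp : p ∈ stdSimplex ℝ A) (n : ℕ) :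
    iid p n ∈ stdSimplex ℝ (Fin n → A) :=
  ⟨iid_nonneg hp.1 n, by
    simp only [iid]
    rw [sum_prod_apply n fun _ => p]
    simp [hp.2]⟩

theorem iidKer_mem_stdSimplex {A : Type*} {K : A → B → ℝ} (hK : ∀ a, K a ∈ stdSimplex ℝ B) (n : ℕ)
    (x : Fin n → A) : iidKer K n x ∈ stdSimplex ℝ (Fin n → B) :=
  ⟨fun _ => Finset.prod_nonneg fun _ _ => (hK _).1 _, by
    simp only [iidKer]
    rw [sum_prod_apply n fun t => K (x t)]
    simp [(hK _).2]⟩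

theorem output_iidKer_iid {B : Type*} (K : A → B → ℝ) (p : A → ℝ) (n : ℕ) :
    output (iidKer K n) (iid p n) = iid (output K p) n := by
  funext y
  simp only [output, iid, iidKer, ← Finset.prod_mul_distrib]
  exact sum_prod_apply n fun t x => p x * K x (y t)

theorem ent_iid {p : A → ℝ} (hp : p ∈ stdSimplex ℝ A) (n : ℕ) : ent (iid p n) = n * ent p := by
  induction n with
  | zero => simp [ent, iid]
  | succ n ih =>
    have h : iid p (n + 1) ∘ (Fin.consEquiv fun _ : Fin (n + 1) => A)
        = compProd p fun _ => iid p n := by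
      funext ⟨a, s⟩
      exact iid_cons p n a s
    rw [← ent_comp_equiv (Fin.consEquiv fun _ : Fin (n + 1) => A) (iid p (n + 1)), h,
      ent_prod _ _ hp.2 (iid_mem_stdSimplex hp n).2, ih]
    push_cast
    ring

end Iid

/-! ### Single-letterization -/

section SingleLetter

universe u

/-- Splitting off one channel output: `H(M, Y, Y') ≥ H(M, Y) + H(Y' | M, X)` when `Y` and `Y'` are
the outputs of separate channels with inputs `X` and `X'`. -/
theorem ent_outputSnd_split {M X X' Y Y' : Type*} [Fintype M] [Fintype X] [Fintype X'] [Fintype Y]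
    [Fintype Y'] {K : X → Y → ℝ} (hK : ∀ x, K x ∈ stdSimplex ℝ Y) {K' : X' → Y' → ℝ}
    (hK' : ∀ x, K' x ∈ stdSimplex ℝ Y') {v : (M × X) × X' → ℝ} (hv : ∀ a, 0 ≤ v a) :
    ent (outputSnd K (margFst v)) + ent (outputSnd K' v)
      ≤ ent (fun a : M × Y × Y' => ∑ x, ∑ x', v ((a.1, x), x') * (K x a.2.1 * K' x' a.2.2))
        + ent (margFst v) := by
  set w := outputSnd K' v with hw
  have hw0 : ∀ a, 0 ≤ w a := outputSnd_nonneg (fun x => (hK' x).1) hv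
  have hwm : margFst w = margFst v := margFst_outputSnd (fun x => (hK' x).2) v
  -- `Y` and `Y'` are conditionally independent given `(M, X)`; submodularity is applied to `Y'` and
  -- `X` given `(M, Y)`
  set p : Y' × X × (M × Y) → ℝ := fun a => w ((a.2.2.1, a.2.1), a.1) * K a.2.1 a.2.2.2 with hp
  have hsub := ent_submodular (p := p) fun a => mul_nonneg (hw0 _) ((hK _).1 _)
  have hS : margSnd p = fun a : X × (M × Y) => margFst v (a.2.1, a.1) * K a.1 a.2.2 := by
    funext a
    simp only [margSnd, hp, ← Finset.sum_mul]
    rw [← hwm]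
    rfl
  have hSS : margSnd (margSnd p) = outputSnd K (margFst v) := by
    rw [hS]
    rfl
  have e1 : ent p = ent w + ∑ a, margFst v a * ent (K a.2) := by
    let e : ((M × X) × Y') × Y ≃ Y' × X × (M × Y) :=
      ⟨fun a => (a.1.2, a.1.1.2, a.1.1.1, a.2), fun a => (((a.2.2.1, a.2.1), a.1), a.2.2.2),
        fun _ => rfl, fun _ => rfl⟩
    have h := ent_compProd w (fun a => K a.1.2) fun a => (hK a.1.2).2
    rw [← ent_comp_equiv e p, show p ∘ e = compProd w fun a => K a.1.2 from rfl, h,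
      Fintype.sum_prod_type (fun a : (M × X) × Y' => w a * ent (K a.1.2)), ← hwm]
    simp only [margFst, Finset.sum_mul]
  have e2 : ent (margSnd p) = ent (margFst v) + ∑ a, margFst v a * ent (K a.2) := by
    let e : (M × X) × Y ≃ X × (M × Y) :=
      ⟨fun a => (a.1.2, a.1.1, a.2), fun a => ((a.2.1, a.1), a.2.2), fun _ => rfl, fun _ => rfl⟩
    rw [hS, ← ent_comp_equiv e, ← ent_compProd _ (fun a : M × X => K a.2) fun a => (hK a.2).2]
    rfl
  have e3 : ent (fun a : Y' × (M × Y) => ∑ x, p (a.1, x, a.2))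
      = ent (fun a : M × Y × Y' => ∑ x, ∑ x', v ((a.1, x), x') * (K x a.2.1 * K' x' a.2.2)) := by
    let e : M × Y × Y' ≃ Y' × (M × Y) :=
      ⟨fun a => (a.2.2, a.1, a.2.1), fun a => (a.2.1, a.2.2, a.1), fun _ => rfl, fun _ => rfl⟩
    rw [← ent_comp_equiv e]
    congr 1
    funext a
    simp only [Function.comp, e, Equiv.coe_fn_mk, hp, hw, outputSnd, Finset.sum_mul]
    exact Finset.sum_congr rfl fun x _ => Finset.sum_congr rfl fun x' _ => by ring
  rw [hSS, e3, e1, e2] at hsub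
  linarith

variable {X : Type*} [Fintype X]

/-- `ent_outputSnd_split` for the first letter and the remaining letters of a block. -/
theorem outputSnd_iidKer_succ {M Y : Type*} [Fintype M] [Fintype Y] {K : X → Y → ℝ}
    (hK : ∀ x, K x ∈ stdSimplex ℝ Y) {n : ℕ} {v : M × (Fin (n + 1) → X) → ℝ} (hv : ∀ a, 0 ≤ v a)
    {v' : (M × X) × (Fin n → X) → ℝ} (hv' : ∀ a, v' a = v (a.1.1, Fin.cons a.1.2 a.2)) :
    ent (outputSnd K (margFst v')) + ent (outputSnd (iidKer K n) v')
      ≤ ent (outputSnd (iidKer K (n + 1)) v) + ent (margFst v') := by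
  have h := ent_outputSnd_split hK (iidKer_mem_stdSimplex hK n) (v := v')
    fun a => by rw [hv']; exact hv _
  refine h.trans_eq ?_
  congr 1
  rw [← ent_comp_equiv
    ((Equiv.refl M).prodCongr (Fin.consEquiv fun _ : Fin (n + 1) => Y)) (outputSnd _ v)]
  congr 1
  funext ⟨m, y, ys⟩
  change _ = ∑ x, v (m, x) * iidKer K (n + 1) x (Fin.cons y ys)
  rw [sum_cons]
  simp only [iidKer_cons, hv']

/-- Version of `exists_mem_infoSet_of_block` with `M` and `X` in one universe. The induction absorbs
the first letter into `M`, which turns the past of the source into the auxiliary variable. -/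
theorem exists_mem_infoSet_of_block_same_universe {X : Type u} [Fintype X] {Y Z : Type*} [Fintype Y] [Fintype Z]
    {P : X → ℝ} {K₁ : X → Y → ℝ} {K₂ : X → Z → ℝ} (hP : P ∈ stdSimplex ℝ X)
    (hK₁ : ∀ x, K₁ x ∈ stdSimplex ℝ Y) (hK₂ : ∀ x, K₂ x ∈ stdSimplex ℝ Z) (n : ℕ) :
    ∀ (M : Type u) [Fintype M] (v : M × (Fin n → X) → ℝ), (∀ a, 0 ≤ v a) →
      margSnd v = iid P n → ∃ t ∈ infoSet P K₁ K₂,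
        ent (margFst v) + n * ent P - ent v = n * t.1 ∧
        ent (margFst v) + n * ent (output K₁ P) - ent (outputSnd (iidKer K₁ n) v) ≤ n * t.2.1 ∧
        ent (margFst v) + n * ent (output K₂ P) - ent (outputSnd (iidKer K₂ n) v)
          ≤ n * t.2.2 := by
  induction n with
  | zero =>
    intro M _ v hv hvP
    refine ⟨0, zero_mem_infoSet hP, ?_, ?_, ?_⟩
    · simp [ent, Fintype.sum_prod_type, margFst]
    · simp [ent, Fintype.sum_prod_type, margFst, outputSnd, iidKer]
    · simp [ent, Fintype.sum_prod_type, margFst, outputSnd, iidKer]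
  | succ n ih =>
    intro M _ v hv hvP
    obtain ⟨v', hv'⟩ : ∃ v' : (M × X) × (Fin n → X) → ℝ,
        ∀ a, v' a = v (a.1.1, Fin.cons a.1.2 a.2) := ⟨_, fun _ => rfl⟩
    have hv0 : ∀ a, 0 ≤ v' a := fun a => by rw [hv']; exact hv _
    have hcons : ∀ x xs, ∑ m, v (m, Fin.cons x xs) = P x * iid P n xs := fun x xs => by
      rw [← iid_cons, ← hvP]
      rfl
    have hm' : margSnd v' = iid P n := by
      funext xs
      simp only [margSnd, hv', Fintype.sum_prod_type]
      rw [Finset.sum_comm]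
      simp only [hcons, ← Finset.sum_mul, hP.2, one_mul]
    have hm0 : margSnd (margFst v') = P := by
      funext x
      simp only [margSnd, margFst, hv']
      rw [Finset.sum_comm]
      simp only [hcons, ← Finset.mul_sum, (iid_mem_stdSimplex hP n).2, mul_one]
    have hmm : margFst (margFst v') = margFst v := by
      funext m
      simp only [margFst, hv']
      rw [sum_cons]
    have hent : ent v' = ent v := by
      let e : (M × X) × (Fin n → X) ≃ M × (Fin (n + 1) → X) :=
        (Equiv.prodAssoc M X (Fin n → X)).trans
          ((Equiv.refl M).prodCongr (Fin.consEquiv fun _ : Fin (n + 1) => X))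
      rw [← ent_comp_equiv e v]
      congr 1
      funext a
      exact hv' a
    obtain ⟨t, ht, h0, h1, h2⟩ := ih (M × X) v' hv0 hm'
    have ht0 := infoTriple_mem_infoSet hP hK₁ hK₂ (margFst_nonneg hv0) hm0
    have g1 := outputSnd_iidKer_succ hK₁ hv hv'
    have g2 := outputSnd_iidKer_succ hK₂ hv hv'
    have hn : (0 : ℝ) < n + 1 := by positivity
    refine ⟨(1 / ((n : ℝ) + 1)) • infoTriple P K₁ K₂ (margFst v') + ((n : ℝ) / (n + 1)) • t,
      convex_infoSet ht0 ht (by positivity) (by positivity) (by field_simp; ring), ?_, ?_, ?_⟩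
    · simp only [Prod.fst_add, Prod.smul_fst, smul_eq_mul, infoTriple, hmm]
      push_cast
      field_simp
      linarith
    · simp only [Prod.fst_add, Prod.snd_add, Prod.smul_fst, Prod.smul_snd, smul_eq_mul, infoTriple,
        hmm]
      push_cast
      field_simp
      linarith
    · simp only [Prod.snd_add, Prod.smul_snd, smul_eq_mul, infoTriple, hmm]
      push_cast
      field_simp
      linarith

/-- The information triple of any `M` correlated with a memoryless block is `n` times a
single-letter triple, with equality for the source and an upper bound for the outputs. -/
theorem exists_mem_infoSet_of_block {X : Type u} [Fintype X] {M Y Z : Type*} [Fintype M] [Fintype Y]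
    [Fintype Z] {P : X → ℝ} {K₁ : X → Y → ℝ} {K₂ : X → Z → ℝ} (hP : P ∈ stdSimplex ℝ X)
    (hK₁ : ∀ x, K₁ x ∈ stdSimplex ℝ Y) (hK₂ : ∀ x, K₂ x ∈ stdSimplex ℝ Z) (n : ℕ)
    (v : M × (Fin n → X) → ℝ) (hv : ∀ a, 0 ≤ v a) (hvP : margSnd v = iid P n) :
    ∃ t ∈ infoSet P K₁ K₂,
      ent (margFst v) + n * ent P - ent v = n * t.1 ∧
      ent (margFst v) + n * ent (output K₁ P) - ent (outputSnd (iidKer K₁ n) v) ≤ n * t.2.1 ∧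
      ent (margFst v) + n * ent (output K₂ P) - ent (outputSnd (iidKer K₂ n) v) ≤ n * t.2.2 := by
  let e : ULift.{u} (Fin (Fintype.card M)) ≃ M := Equiv.ulift.trans (Fintype.equivFin M).symm
  have h := exists_mem_infoSet_of_block_same_universe hP hK₁ hK₂ n _
    (v ∘ e.prodCongr (Equiv.refl _)) (fun a => hv _) (by
      rw [← hvP]
      funext x
      exact e.sum_comp fun m => v (m, x))
  have hm : margFst (v ∘ e.prodCongr (Equiv.refl _)) = margFst v ∘ e := rfl
  have hout : ∀ {W : Type _} (k : (Fin n → X) → W → ℝ),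
      outputSnd k (v ∘ e.prodCongr (Equiv.refl _))
        = outputSnd k v ∘ e.prodCongr (Equiv.refl W) := fun k => rfl
  -- repeated, since the universe of `W` is fixed within each `have`
  have hout' : ∀ {W : Type _} (k : (Fin n → X) → W → ℝ),
      outputSnd k (v ∘ e.prodCongr (Equiv.refl _))
        = outputSnd k v ∘ e.prodCongr (Equiv.refl W) := fun k => rfl
  rw [hm, ent_comp_equiv, ent_comp_equiv, hout, ent_comp_equiv, hout', ent_comp_equiv] at h
  exact h

end SingleLetter

/-! ### Images of distributions -/

section Push

variable {A B C : Type*} [Fintype A] [Fintype B] [Fintype C]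

omit [Fintype C] in
theorem push_push (f : A → B) (g : B → C) (p : A → ℝ) :
    push g (push f p) = push (fun a => g (f a)) p := by
  classical
  funext c
  simp only [push]
  rw [← Finset.sum_fiberwise_of_maps_to (s := Finset.univ.filter fun a => g (f a) = c)
    (t := Finset.univ.filter fun b => g b = c) (g := f) (by simp)]
  refine Finset.sum_congr (by ext; simp) fun b hb => Finset.sum_congr ?_ fun _ _ => rfl
  ext a
  simp only [Finset.mem_filter, Finset.mem_univ, true_and] at hb ⊢
  exact ⟨fun h => ⟨by rw [h, hb], h⟩, fun h => h.2⟩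

omit [Fintype B] in
theorem push_apply [DecidableEq B] (f : A → B) (p : A → ℝ) (b : B) :
    push f p b = ∑ a, if f a = b then p a else 0 := by
  rw [push, Finset.sum_filter]
  exact Finset.sum_congr rfl fun a _ => by congr

theorem sum_push_mul (f : A → B) (p : A → ℝ) (F : B → ℝ) :
    ∑ b, push f p b * F b = ∑ a, p a * F (f a) := by
  classical
  rw [← Finset.sum_fiberwise Finset.univ f]
  refine Finset.sum_congr rfl fun b _ => ?_
  rw [push, Finset.sum_mul]
  refine Finset.sum_congr (by ext; simp) fun a ha => ?_
  rw [(Finset.mem_filter.1 ha).2]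

theorem push_mem_stdSimplex (f : A → B) {p : A → ℝ} (hp : p ∈ stdSimplex ℝ A) :
    push f p ∈ stdSimplex ℝ B :=
  ⟨push_nonneg f hp.1, by simpa [hp.2] using sum_push_mul f p fun _ => 1⟩

omit [Fintype C] in
theorem push_fst (p : A × B → ℝ) : push Prod.fst p = margFst p := by
  classical
  funext a
  rw [push_apply, Fintype.sum_prod_type, Finset.sum_eq_single a]
  · simp [margFst]
  · intro a' _ h
    simp [h]
  · simp

omit [Fintype C] in
theorem push_snd (p : A × B → ℝ) : push Prod.snd p = margSnd p := by
  classical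
  funext b
  rw [push_apply, Fintype.sum_prod_type_right, Finset.sum_eq_single b]
  · simp [margSnd]
  · intro b' _ h
    simp [h]
  · simp

theorem margFst_push (f : A → B × C) (p : A → ℝ) :
    margFst (push f p) = push (fun a => (f a).1) p := by
  rw [← push_fst, push_push]

theorem margSnd_push (f : A → B × C) (p : A → ℝ) :
    margSnd (push f p) = push (fun a => (f a).2) p := by
  rw [← push_snd, push_push]

omit [Fintype B] [Fintype C] in
theorem push_eq_zero_of_abs_cont (f : A → B) {p r : A → ℝ} (hr : ∀ a, 0 ≤ r a)
    (hpr : ∀ a, r a = 0 → p a = 0) {b : B} (h : push f r b = 0) : push f p b = 0 :=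
  Finset.sum_eq_zero fun a ha =>
    hpr a ((Finset.sum_eq_zero_iff_of_nonneg fun a _ => hr a).1 h a ha)

theorem ent_push_graph (f : A → B) (p : A → ℝ) : ent (push (fun a => (f a, a)) p) = ent p := by
  classical
  have h : ∀ b a, push (fun a => (f a, a)) p (b, a) = if f a = b then p a else 0 := by
    intro b a
    rw [push_apply, Finset.sum_eq_single a]
    · simp
    · intro a' _ h
      simp [h]
    · simp
  simp only [ent, Fintype.sum_prod_type_right, h]
  refine Finset.sum_congr rfl fun a _ => ?_
  rw [Finset.sum_eq_single (f a)]
  · simp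
  · intro b _ hb
    simp [hb.symm]
  · simp

/-! ### Bounds on entropy and a single-shot converse for testing -/

theorem ent_nonneg {p : A → ℝ} (hp : p ∈ stdSimplex ℝ A) : 0 ≤ ent p :=
  Finset.sum_nonneg fun a _ => Real.negMulLog_nonneg (hp.1 a)
    (hp.2 ▸ Finset.single_le_sum (fun a _ => hp.1 a) (Finset.mem_univ a))

theorem ent_le_log_card {p : A → ℝ} (hp : p ∈ stdSimplex ℝ A) :
    ent p ≤ Real.log (Fintype.card A) := by
  have h := sum_mul_log_div_le Finset.univ hp.1 (fun _ => zero_le_one : ∀ _ : A, (0 : ℝ) ≤ 1)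
    fun _ h => absurd h one_ne_zero
  simp only [hp.2, one_mul, div_one, Finset.sum_const, Finset.card_univ, nsmul_eq_mul, mul_one,
    one_div, Real.log_inv] at h
  have e : ∑ a, p a * Real.log (p a) = -ent p := by
    simp [ent, Real.negMulLog]
  linarith

theorem ent_margFst_le {p : A × B → ℝ} (hp : p ∈ stdSimplex ℝ (A × B)) :
    ent (margFst p) ≤ ent p := by
  have : margSnd p ∈ stdSimplex ℝ B := push_snd p ▸ push_mem_stdSimplex _ hp
  obtain ⟨k, hk, h⟩ := exists_eq_compProd hp.1 this
  have := ent_compProd (margFst p) k fun a => (hk a).2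
  rw [← h] at this
  rw [this, le_add_iff_nonneg_right]
  exact Finset.sum_nonneg fun a _ => mul_nonneg (margFst_nonneg hp.1 a) (ent_nonneg (hk a))

theorem ent_le_ent_margFst_add {p : A × B → ℝ} (hp : p ∈ stdSimplex ℝ (A × B)) :
    ent p ≤ ent (margFst p) + Real.log (Fintype.card B) := by
  have h0 : margSnd p ∈ stdSimplex ℝ B := push_snd p ▸ push_mem_stdSimplex _ hp
  obtain ⟨k, hk, h⟩ := exists_eq_compProd hp.1 h0
  have := ent_compProd (margFst p) k fun a => (hk a).2
  rw [← h] at this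
  rw [this, add_le_add_iff_left]
  calc ∑ a, margFst p a * ent (k a)
      ≤ ∑ a, margFst p a * Real.log (Fintype.card B) := Finset.sum_le_sum fun a _ =>
        mul_le_mul_of_nonneg_left (ent_le_log_card (hk a)) (margFst_nonneg hp.1 a)
    _ = Real.log (Fintype.card B) := by rw [← Finset.sum_mul, sum_margFst, hp.2, one_mul]

omit [Fintype C] in
theorem mutualInfo_eq_kl (p : A × B → ℝ) :
    mutualInfo p = kl p (compProd (margFst p) fun _ => margSnd p) := by
  simp only [mutualInfo, kl, Fintype.sum_prod_type, compProd]

omit [Fintype C] in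
/-- Relative entropy to a product law that has the right second marginal. -/
theorem kl_compProd_margSnd {p : A × B → ℝ} (hp : ∀ x, 0 ≤ p x) {r : A → ℝ}
    (hpr : ∀ a, r a = 0 → margFst p a = 0) :
    kl p (compProd r fun _ => margSnd p) = kl (margFst p) r + mutualInfo p := by
  simp only [mutualInfo, kl, Fintype.sum_prod_type, compProd]
  rw [← Finset.sum_add_distrib]
  refine Finset.sum_congr rfl fun a _ => ?_
  have e : margFst p a * Real.log (margFst p a / r a)
      = ∑ b, p (a, b) * Real.log (margFst p a / r a) := Finset.sum_mul ..
  rw [e, ← Finset.sum_add_distrib]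
  refine Finset.sum_congr rfl fun b _ => ?_
  by_cases h : p (a, b) = 0
  · simp [h]
  · have h1 : margFst p a ≠ 0 := fun h0 => h (eq_zero_of_margFst_eq_zero hp h0 b)
    have h2 : margSnd p b ≠ 0 := fun h0 => h (eq_zero_of_margSnd_eq_zero hp h0 a)
    have h3 : r a ≠ 0 := fun h0 => h1 (hpr a h0)
    rw [Real.log_div h (mul_ne_zero h3 h2), Real.log_div h (mul_ne_zero h1 h2),
      Real.log_div h1 h3, Real.log_mul h3 h2, Real.log_mul h1 h2]
    ring

omit [Fintype B] [Fintype C] in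
/-- Weak converse for binary hypothesis testing: relative entropy bounds the exponent of the
probability under `r` of an acceptance region that is likely under `p`. -/
theorem mul_neg_log_le_kl {p r : A → ℝ} (hp : p ∈ stdSimplex ℝ A) (hr : r ∈ stdSimplex ℝ A)
    (hpr : ∀ a, r a = 0 → p a = 0) (S : Finset A) (hS : 0 < ∑ a ∈ S, p a) :
    0 < ∑ a ∈ S, r a ∧
      (∑ a ∈ S, p a) * -Real.log (∑ a ∈ S, r a) ≤ kl p r + Real.log 2 := by
  classical
  have hβ : 0 < ∑ a ∈ S, r a := by
    refine (Finset.sum_nonneg fun a _ => hr.1 a).lt_of_ne fun h => hS.ne' ?_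
    exact Finset.sum_eq_zero fun a ha =>
      hpr a ((Finset.sum_eq_zero_iff_of_nonneg fun a _ => hr.1 a).1 h.symm a ha)
  refine ⟨hβ, ?_⟩
  have h1 := sum_mul_log_div_le S hp.1 hr.1 hpr
  have h2 := sum_mul_log_div_le Sᶜ hp.1 hr.1 hpr
  have hpc : ∑ a ∈ Sᶜ, p a = 1 - ∑ a ∈ S, p a := by
    rw [← hp.2, ← Finset.sum_add_sum_compl S p]
    ring
  have hkl : kl p r = ∑ a ∈ S, p a * Real.log (p a / r a)
      + ∑ a ∈ Sᶜ, p a * Real.log (p a / r a) := (Finset.sum_add_sum_compl S _).symm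
  have hrc1 : ∑ a ∈ Sᶜ, r a ≤ 1 :=
    hr.2 ▸ Finset.sum_le_univ_sum_of_nonneg hr.1
  have hrc0 : 0 ≤ ∑ a ∈ Sᶜ, r a := Finset.sum_nonneg fun a _ => hr.1 a
  have hpc0 : 0 ≤ ∑ a ∈ Sᶜ, p a := Finset.sum_nonneg fun a _ => hp.1 a
  rw [Real.log_div hS.ne' hβ.ne'] at h1
  have h3 : (∑ a ∈ Sᶜ, p a) * Real.log (∑ a ∈ Sᶜ, p a)
      ≤ (∑ a ∈ Sᶜ, p a) * Real.log ((∑ a ∈ Sᶜ, p a) / ∑ a ∈ Sᶜ, r a) := by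
    rcases hpc0.eq_or_lt with h | h
    · rw [← h]
      simp
    · rcases hrc0.eq_or_lt with h' | h'
      · refine absurd (Finset.sum_eq_zero fun a ha => ?_) h.ne'
        exact hpr a ((Finset.sum_eq_zero_iff_of_nonneg fun a _ => hr.1 a).1 h'.symm a ha)
      · rw [Real.log_div h.ne' h'.ne']
        nlinarith [Real.log_nonpos hrc0 hrc1]
  have h4 := Real.binEntropy_le_log_two (p := ∑ a ∈ S, p a)
  rw [Real.binEntropy_eq_negMulLog_add_negMulLog_one_sub, ← hpc, Real.negMulLog,
    Real.negMulLog] at h4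
  nlinarith

end Push

/-! ### The laws seen by the detectors -/

section Laws

variable {X Y₁ Y₂ : Type*} [Fintype X] [Fintype Y₁] [Fintype Y₂]

/-- The product law of the three components of `P`, i.e. the law under the hypothesis of mutual
independence. -/
def indepLaw (P : X × Y₁ × Y₂ → ℝ) (a : X × Y₁ × Y₂) : ℝ :=
  margFst P a.1 * margFst (margSnd P) a.2.1 * margSnd (margSnd P) a.2.2

variable {P : X × Y₁ × Y₂ → ℝ}

theorem margFst_mem_stdSimplex {A B : Type*} [Fintype A] [Fintype B] {p : A × B → ℝ}
    (hp : p ∈ stdSimplex ℝ (A × B)) : margFst p ∈ stdSimplex ℝ A :=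
  push_fst p ▸ push_mem_stdSimplex _ hp

theorem margSnd_mem_stdSimplex {A B : Type*} [Fintype A] [Fintype B] {p : A × B → ℝ}
    (hp : p ∈ stdSimplex ℝ (A × B)) : margSnd p ∈ stdSimplex ℝ B :=
  push_snd p ▸ push_mem_stdSimplex _ hp

theorem indepLaw_mem_stdSimplex (hP : P ∈ stdSimplex ℝ (X × Y₁ × Y₂)) :
    indepLaw P ∈ stdSimplex ℝ (X × Y₁ × Y₂) := by
  have hX := margFst_mem_stdSimplex hP
  have h1 := margFst_mem_stdSimplex (margSnd_mem_stdSimplex hP)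
  have h2 := margSnd_mem_stdSimplex (margSnd_mem_stdSimplex hP)
  refine ⟨fun a => mul_nonneg (mul_nonneg (hX.1 _) (h1.1 _)) (h2.1 _), ?_⟩
  simp only [indepLaw, Fintype.sum_prod_type, ← Finset.mul_sum, h2.2, mul_one, h1.2, hX.2]

theorem eq_zero_of_indepLaw_eq_zero (hP : P ∈ stdSimplex ℝ (X × Y₁ × Y₂)) (a : X × Y₁ × Y₂)
    (h : indepLaw P a = 0) : P a = 0 := by
  obtain ⟨x, y₁, y₂⟩ := a
  simp only [indepLaw, mul_eq_zero] at h
  have hs := margSnd_nonneg hP.1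
  rcases h with (h | h) | h
  · exact eq_zero_of_margFst_eq_zero hP.1 h _
  · exact eq_zero_of_margSnd_eq_zero hP.1 (eq_zero_of_margFst_eq_zero hs h y₂) x
  · exact eq_zero_of_margSnd_eq_zero hP.1 (eq_zero_of_margSnd_eq_zero hs h y₁) x

theorem iid_eq_zero_of_abs_cont {A : Type*} {p r : A → ℝ} (hpr : ∀ a, r a = 0 → p a = 0) {n : ℕ}
    (s : Fin n → A) (h : iid r n s = 0) : iid p n s = 0 := by
  obtain ⟨t, ht, h0⟩ := Finset.prod_eq_zero_iff.1 h
  exact Finset.prod_eq_zero ht (hpr _ h0)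

/-- Sums over sequences of triples as sums over triples of sequences. -/
theorem sum_triple (n : ℕ) (F : (Fin n → X × Y₁ × Y₂) → ℝ) :
    ∑ s, F s = ∑ x : Fin n → X, ∑ y₁ : Fin n → Y₁, ∑ y₂ : Fin n → Y₂,
      F fun t => (x t, y₁ t, y₂ t) := by
  let e : (Fin n → X) × (Fin n → Y₁) × (Fin n → Y₂) ≃ (Fin n → X × Y₁ × Y₂) :=
    ⟨fun a t => (a.1 t, a.2.1 t, a.2.2 t),
      fun s => (fun t => (s t).1, fun t => (s t).2.1, fun t => (s t).2.2),
      fun _ => rfl, fun _ => rfl⟩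
  rw [← e.sum_comp, Fintype.sum_prod_type]
  simp only [Fintype.sum_prod_type]
  rfl

omit [Fintype Y₁] in
theorem margFst_margSnd_compProd (w : X → ℝ) (K : X → Y₁ × Y₂ → ℝ) :
    margFst (margSnd (compProd w K)) = output (fun x => margFst (K x)) w := by
  funext y
  simp only [margFst, margSnd, compProd, output, Finset.mul_sum]
  exact Finset.sum_comm

omit [Fintype Y₂] in
theorem margSnd_margSnd_compProd (w : X → ℝ) (K : X → Y₁ × Y₂ → ℝ) :
    margSnd (margSnd (compProd w K)) = output (fun x => margSnd (K x)) w := by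
  funext y
  simp only [margSnd, compProd, output, Finset.mul_sum]
  exact Finset.sum_comm

/-- The law of the message and the first output: the message is a function of the source block, and
the output block is produced from the source block by the memoryless channel. -/
theorem push_enc_fst {n : ℕ} {M : Type*} (w : X → ℝ) (K : X → Y₁ × Y₂ → ℝ)
    (f : (Fin n → X) → M) :
    push (fun s : Fin n → X × Y₁ × Y₂ => (f fun t => (s t).1, fun t => (s t).2.1))
        (iid (compProd w K) n)
      = outputSnd (iidKer (fun x => margFst (K x)) n)
          (push (fun x => (f x, x)) (iid w n)) := by
  classical
  funext ⟨m, y⟩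
  have hK : ∀ x : Fin n → X, ∑ y₂ : Fin n → Y₂, ∏ t, K (x t) (y t, y₂ t)
      = iidKer (fun x => margFst (K x)) n x y := fun x =>
    sum_prod_apply n fun t b => K (x t) (y t, b)
  simp only [push_apply, outputSnd, sum_triple, Prod.mk.injEq, iid, compProd, Finset.sum_mul,
    Finset.prod_mul_distrib]
  rw [Finset.sum_comm (s := Finset.univ) (t := Finset.univ)
    (f := fun x x' => (if f x' = m ∧ x' = x then ∏ t, w (x' t) else 0) * _)]
  refine Finset.sum_congr rfl fun x _ => ?_
  rw [Finset.sum_eq_single y, Finset.sum_eq_single x]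
  · by_cases h : f x = m
    · simp only [h, and_self, if_true, ← Finset.mul_sum, hK]
    · simp [h]
  · intro x' _ h
    simp [h.symm]
  · simp
  · intro y' _ h
    simp [h]
  · simp

theorem push_enc_snd {n : ℕ} {M : Type*} (w : X → ℝ) (K : X → Y₁ × Y₂ → ℝ)
    (f : (Fin n → X) → M) :
    push (fun s : Fin n → X × Y₁ × Y₂ => (f fun t => (s t).1, fun t => (s t).2.2))
        (iid (compProd w K) n)
      = outputSnd (iidKer (fun x => margSnd (K x)) n)
          (push (fun x => (f x, x)) (iid w n)) := by
  classical
  funext ⟨m, y⟩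
  have hK : ∀ x : Fin n → X, ∑ y₁ : Fin n → Y₁, ∏ t, K (x t) (y₁ t, y t)
      = iidKer (fun x => margSnd (K x)) n x y := fun x =>
    sum_prod_apply n fun t b => K (x t) (b, y t)
  simp only [push_apply, outputSnd, sum_triple, Prod.mk.injEq, iid, compProd, Finset.sum_mul,
    Finset.prod_mul_distrib]
  rw [Finset.sum_comm (s := Finset.univ) (t := Finset.univ)
    (f := fun x x' => (if f x' = m ∧ x' = x then ∏ t, w (x' t) else 0) * _)]
  refine Finset.sum_congr rfl fun x _ => ?_
  rw [Finset.sum_comm, Finset.sum_eq_single y, Finset.sum_eq_single x]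
  · by_cases h : f x = m
    · simp only [h, and_self, if_true, ← Finset.mul_sum, hK]
    · simp [h]
  · intro x' _ h
    simp [h.symm]
  · simp
  · intro y' _ h
    simp [h]
  · simp

/-- Under `indepLaw P`, a function of the first two blocks is independent of the third block. -/
theorem push_indepLaw_snd (hP : P ∈ stdSimplex ℝ (X × Y₁ × Y₂)) {n : ℕ} {M : Type*}
    (f : (Fin n → X) → (Fin n → Y₁) → M) :
    push (fun s : Fin n → X × Y₁ × Y₂ =>
        (f (fun t => (s t).1) fun t => (s t).2.1, fun t => (s t).2.2)) (iid (indepLaw P) n)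
      = compProd (push (fun s : Fin n → X × Y₁ × Y₂ => f (fun t => (s t).1) fun t => (s t).2.1)
          (iid (indepLaw P) n)) fun _ => iid (margSnd (margSnd P)) n := by
  classical
  have h2 := (iid_mem_stdSimplex (margSnd_mem_stdSimplex (margSnd_mem_stdSimplex hP)) n).2
  funext ⟨m, y⟩
  simp only [push_apply, sum_triple, Prod.mk.injEq, iid, compProd, indepLaw, Finset.sum_mul,
    Finset.prod_mul_distrib] at h2 ⊢
  refine Finset.sum_congr rfl fun x _ => Finset.sum_congr rfl fun y₁ _ => ?_
  by_cases h : f x y₁ = m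
  · simp only [h, true_and, if_true, ← Finset.sum_mul, ← Finset.mul_sum, h2, mul_one]
    change ∑ z : Fin n → Y₂, (if z = y then _ else _) = _
    simp
  · simp [h]

/-- Under `indepLaw P`, a function of the first block is independent of the second block. -/
theorem push_indepLaw_fst (hP : P ∈ stdSimplex ℝ (X × Y₁ × Y₂)) {n : ℕ} {M : Type*}
    (f : (Fin n → X) → M) :
    push (fun s : Fin n → X × Y₁ × Y₂ => (f fun t => (s t).1, fun t => (s t).2.1))
        (iid (indepLaw P) n)
      = compProd (push f (iid (margFst P) n)) fun _ => iid (margFst (margSnd P)) n := by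
  classical
  have h2 := (iid_mem_stdSimplex (margSnd_mem_stdSimplex (margSnd_mem_stdSimplex hP)) n).2
  funext ⟨m, y⟩
  simp only [push_apply, sum_triple, Prod.mk.injEq, iid, compProd, indepLaw, Finset.sum_mul,
    Finset.prod_mul_distrib] at h2 ⊢
  refine Finset.sum_congr rfl fun x _ => ?_
  by_cases h : f x = m
  · rw [Finset.sum_eq_single y]
    · simp only [h, true_and, if_true, ← Finset.mul_sum, h2, mul_one]
    · intro y' _ h'
      simp [h']
    · simp
  · simp [h]

end Laws

/-! ### Finite-blocklength converse -/

section Converse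

variable {X Y₁ Y₂ : Type*} [Fintype X] [Fintype Y₁] [Fintype Y₂] {n : ℕ}

theorem probGuess_eq_sum_push {A Z : Type*} [Fintype A] [Fintype Z] (p : A → ℝ)
    (T : (Fin n → A) → Z) (dec : Z → Fin 2) (h : Fin 2) :
    probGuess p (fun s => dec (T s)) h = ∑ z with dec z = h, push T (iid p n) z := by
  have := sum_push_mul T (iid p n) fun z => if dec z = h then 1 else 0
  simp only [mul_ite, mul_one, mul_zero, ← Finset.sum_filter] at this
  exact this.symm

theorem probGuess_zero_add_one {A : Type*} [Fintype A] {p : A → ℝ} (hp : p ∈ stdSimplex ℝ A)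
    (g : (Fin n → A) → Fin 2) : probGuess p g 0 + probGuess p g 1 = 1 := by
  have h := Finset.sum_fiberwise Finset.univ g (iid p n)
  rw [Fin.sum_univ_two, (iid_mem_stdSimplex hp n).2] at h
  exact h

/-- Exponent bound for a detector whose decision depends on the sources through `T`. -/
theorem probGuess_mul_neg_log_le {A Z : Type*} [Fintype A] [Fintype Z] {p r : A → ℝ}
    (hp : p ∈ stdSimplex ℝ A) (hr : r ∈ stdSimplex ℝ A) (hpr : ∀ a, r a = 0 → p a = 0)
    (T : (Fin n → A) → Z) (dec : Z → Fin 2) (hα : probGuess p (fun s => dec (T s)) 1 < 1) :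
    0 < probGuess r (fun s => dec (T s)) 0 ∧
      (1 - probGuess p (fun s => dec (T s)) 1) * -Real.log (probGuess r (fun s => dec (T s)) 0)
        ≤ kl (push T (iid p n)) (push T (iid r n)) + Real.log 2 := by
  have h1 := probGuess_zero_add_one hp fun s => dec (T s)
  rw [← eq_sub_iff_add_eq] at h1
  rw [← h1]
  have hpos : 0 < probGuess p (fun s => dec (T s)) 0 := by linarith
  rw [probGuess_eq_sum_push] at hpos ⊢
  rw [probGuess_eq_sum_push]
  exact mul_neg_log_le_kl (push_mem_stdSimplex _ (iid_mem_stdSimplex hp n))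
    (push_mem_stdSimplex _ (iid_mem_stdSimplex hr n))
    (fun z => push_eq_zero_of_abs_cont _ (iid_nonneg hr.1 n) (iid_eq_zero_of_abs_cont hpr)) _ hpos

/-- Joint law of the message of the sensor and the source block. -/
noncomputable def Code.msgLaw (c : Code X Y₁ Y₂ n) (w : X → ℝ) :
    Fin c.W₁ × (Fin n → X) → ℝ :=
  push (fun x => (c.enc₁ x, x)) (iid w n)

omit [Fintype Y₁] [Fintype Y₂] in
theorem Code.margSnd_msgLaw (c : Code X Y₁ Y₂ n) (w : X → ℝ) :
    margSnd (c.msgLaw w) = iid w n := by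
  classical
  rw [Code.msgLaw, margSnd_push]
  funext x
  rw [push_apply]
  simp

omit [Fintype Y₁] [Fintype Y₂] in
theorem Code.margFst_msgLaw (c : Code X Y₁ Y₂ n) (w : X → ℝ) :
    margFst (c.msgLaw w) = push c.enc₁ (iid w n) :=
  margFst_push _ _

omit [Fintype Y₁] [Fintype Y₂] in
theorem Code.ent_margFst_msgLaw_le (c : Code X Y₁ Y₂ n) {w : X → ℝ} (hw : w ∈ stdSimplex ℝ X) :
    ent (margFst (c.msgLaw w)) ≤ Real.log c.W₁ := by
  rw [c.margFst_msgLaw]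
  simpa using ent_le_log_card (push_mem_stdSimplex c.enc₁ (iid_mem_stdSimplex hw n))

variable {w : X → ℝ} {K : X → Y₁ × Y₂ → ℝ}

/-- The law of the observations of Detector 1 has relative entropy `I(M₁; Y₁ⁿ)`. -/
theorem Code.kl_obs₁ (c : Code X Y₁ Y₂ n) (hw : w ∈ stdSimplex ℝ X)
    (hK : ∀ x, K x ∈ stdSimplex ℝ (Y₁ × Y₂)) :
    kl (push (fun s : Fin n → X × Y₁ × Y₂ => (c.enc₁ fun t => (s t).1, fun t => (s t).2.1))
        (iid (compProd w K) n))
      (push (fun s : Fin n → X × Y₁ × Y₂ => (c.enc₁ fun t => (s t).1, fun t => (s t).2.1))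
        (iid (indepLaw (compProd w K)) n))
      = ent (margFst (c.msgLaw w)) + n * ent (output (fun x => margFst (K x)) w)
        - ent (outputSnd (iidKer (fun x => margFst (K x)) n) (c.msgLaw w)) := by
  have hK₁ : ∀ x, margFst (K x) ∈ stdSimplex ℝ Y₁ := fun x => margFst_mem_stdSimplex (hK x)
  have hKn := iidKer_mem_stdSimplex hK₁ n
  have hvnn : ∀ a, 0 ≤ c.msgLaw w a := push_nonneg _ (iid_nonneg hw.1 n)
  have h1 := push_enc_fst w K c.enc₁
  have h2 := push_indepLaw_fst (compProd_mem_stdSimplex hw hK) c.enc₁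
  have hF : margFst (outputSnd (iidKer (fun x => margFst (K x)) n) (c.msgLaw w))
      = push c.enc₁ (iid w n) := by
    rw [margFst_outputSnd (fun x => (hKn x).2), c.margFst_msgLaw]
  have hS : margSnd (outputSnd (iidKer (fun x => margFst (K x)) n) (c.msgLaw w))
      = iid (output (fun x => margFst (K x)) w) n := by
    rw [margSnd_outputSnd, c.margSnd_msgLaw, output_iidKer_iid]
  rw [h1, h2, margFst_compProd fun x => (hK x).2, margFst_margSnd_compProd, ← hF, ← hS]
  change kl (outputSnd _ (c.msgLaw w)) (compProd (margFst (outputSnd _ (c.msgLaw w))) _) = _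
  rw [← mutualInfo_eq_kl, mutualInfo_eq_ent (outputSnd_nonneg (fun x => (hKn x).1) hvnn), hF, hS,
    c.margFst_msgLaw, ent_iid (output_mem_stdSimplex hK₁ hw)]

/-- The law of the observations of Detector 2 has relative entropy at most
`I(M₁; Y₁ⁿ) + I(M₁; Y₂ⁿ) + log W₂`. -/
theorem Code.kl_obs₂_le (c : Code X Y₁ Y₂ n) (hw : w ∈ stdSimplex ℝ X)
    (hK : ∀ x, K x ∈ stdSimplex ℝ (Y₁ × Y₂)) :
    kl (push (fun s : Fin n → X × Y₁ × Y₂ => ((c.enc₁ fun t => (s t).1,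
          c.enc₂ (c.enc₁ fun t => (s t).1) fun t => (s t).2.1), fun t => (s t).2.2))
        (iid (compProd w K) n))
      (push (fun s : Fin n → X × Y₁ × Y₂ => ((c.enc₁ fun t => (s t).1,
          c.enc₂ (c.enc₁ fun t => (s t).1) fun t => (s t).2.1), fun t => (s t).2.2))
        (iid (indepLaw (compProd w K)) n))
      ≤ (ent (margFst (c.msgLaw w)) + n * ent (output (fun x => margFst (K x)) w)
          - ent (outputSnd (iidKer (fun x => margFst (K x)) n) (c.msgLaw w)))
        + (ent (margFst (c.msgLaw w)) + n * ent (output (fun x => margSnd (K x)) w)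
          - ent (outputSnd (iidKer (fun x => margSnd (K x)) n) (c.msgLaw w)))
        + Real.log c.W₂ := by
  set P := compProd w K with hPdef
  have hP : P ∈ stdSimplex ℝ _ := compProd_mem_stdSimplex hw hK
  have hPn := iid_mem_stdSimplex hP n
  have hQn := iid_mem_stdSimplex (indepLaw_mem_stdSimplex hP) n
  have hac : ∀ s : Fin n → X × Y₁ × Y₂, iid (indepLaw P) n s = 0 → iid P n s = 0 :=
    iid_eq_zero_of_abs_cont (eq_zero_of_indepLaw_eq_zero hP)
  have hK₂ : ∀ x, margSnd (K x) ∈ stdSimplex ℝ Y₂ := fun x => margSnd_mem_stdSimplex (hK x)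
  have hKn := iidKer_mem_stdSimplex hK₂ n
  set T₁ : (Fin n → X × Y₁ × Y₂) → Fin c.W₁ × (Fin n → Y₁) :=
    fun s => (c.enc₁ fun t => (s t).1, fun t => (s t).2.1) with hT₁
  set T₂ : (Fin n → X × Y₁ × Y₂) → (Fin c.W₁ × Fin c.W₂) × (Fin n → Y₂) :=
    fun s => ((c.enc₁ fun t => (s t).1,
      c.enc₂ (c.enc₁ fun t => (s t).1) fun t => (s t).2.1), fun t => (s t).2.2) with hT₂
  let g : Fin c.W₁ × (Fin n → Y₁) → Fin c.W₁ × Fin c.W₂ := fun a => (a.1, c.enc₂ a.1 a.2)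
  -- the law of `(M₁, M₂)` is the image under `g` of the law of `(M₁, Y₁ⁿ)`
  have hpair : ∀ p : (Fin n → X × Y₁ × Y₂) → ℝ,
      push (fun s => (T₂ s).1) p = push g (push T₁ p) := fun p => (push_push T₁ g p).symm
  have hfac : push T₂ (iid (indepLaw P) n)
      = compProd (push g (push T₁ (iid (indepLaw P) n)))
          fun _ => iid (margSnd (margSnd P)) n := by
    rw [← hpair]
    exact push_indepLaw_snd hP fun x y₁ => (c.enc₁ x, c.enc₂ (c.enc₁ x) y₁)
  set V := push T₂ (iid P n) with hV
  have hVmem : V ∈ stdSimplex ℝ _ := push_mem_stdSimplex _ hPn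
  have hVF : margFst V = push g (push T₁ (iid P n)) := by rw [hV, margFst_push, hpair]
  -- the pair `(M₁, Y₂ⁿ)`
  set U := outputSnd (iidKer (fun x => margSnd (K x)) n) (c.msgLaw w) with hU
  let d : (Fin c.W₁ × Fin c.W₂) × (Fin n → Y₂) → Fin c.W₁ × (Fin n → Y₂) := fun a => (a.1.1, a.2)
  have hUpush : push d V = U := by
    rw [hV, push_push]
    exact push_enc_snd w K c.enc₁
  have hVS : margSnd V = iid (margSnd (margSnd P)) n := by
    have : margSnd V = margSnd U := by
      rw [← hUpush, ← push_snd V, ← push_snd (push _ V)]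
      exact (push_push d Prod.snd V).symm
    rw [this, hU, margSnd_outputSnd, c.margSnd_msgLaw, output_iidKer_iid, hPdef,
      margSnd_margSnd_compProd]
  have hVFF : margFst (margFst V) = margFst (c.msgLaw w) := by
    have : margFst (margFst V) = margFst U := by
      rw [← hUpush, ← push_fst V, ← push_fst (push _ V), ← push_fst (push _ V)]
      exact (push_push Prod.fst Prod.fst V).trans (push_push d Prod.fst V).symm
    rw [this, hU, margFst_outputSnd fun x => (hKn x).2]
  have hUV : ent U ≤ ent V := by
    let e : ((Fin c.W₁ × (Fin n → Y₂)) × Fin c.W₂) ≃ (Fin c.W₁ × Fin c.W₂) × (Fin n → Y₂) :=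
      ⟨fun a => ((a.1.1, a.2), a.1.2), fun a => ((a.1.1, a.2), a.1.2), fun _ => rfl, fun _ => rfl⟩
    have he : V ∘ e ∈ stdSimplex ℝ _ :=
      ⟨fun a => hVmem.1 _, (e.sum_comp V).trans hVmem.2⟩
    have hUe : U = margFst (V ∘ e) := by
      classical
      rw [← hUpush]
      funext ⟨m, y⟩
      rw [push_apply, ← e.sum_comp, Fintype.sum_prod_type, Finset.sum_eq_single (m, y)]
      · simp [d, e, margFst]
      · intro a _ ha
        simp [d, e, ha]
      · simp
    rw [hUe, ← ent_comp_equiv e V]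
    exact ent_margFst_le he
  have hdp : kl (margFst V) (push g (push T₁ (iid (indepLaw P) n)))
      ≤ kl (push T₁ (iid P n)) (push T₁ (iid (indepLaw P) n)) := by
    rw [hVF]
    exact kl_push_le g (push_nonneg _ hPn.1) (push_nonneg _ hQn.1)
      fun z => push_eq_zero_of_abs_cont _ hQn.1 hac
  have hz : ∀ a, push g (push T₁ (iid (indepLaw P) n)) a = 0 → margFst V a = 0 := by
    intro a ha
    rw [hVF]
    exact push_eq_zero_of_abs_cont g (push_nonneg _ hQn.1)
      (fun z => push_eq_zero_of_abs_cont _ hQn.1 hac) ha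
  have hm := ent_le_ent_margFst_add (margFst_mem_stdSimplex hVmem)
  rw [hVFF, Fintype.card_fin] at hm
  rw [hfac, ← hVS, kl_compProd_margSnd hVmem.1 hz, mutualInfo_eq_ent hVmem.1, hVS, hPdef,
    margSnd_margSnd_compProd, ent_iid (output_mem_stdSimplex hK₂ hw)]
  have h1 := c.kl_obs₁ hw hK
  rw [← hPdef] at h1 ⊢
  linarith

end Converse

/-! ### Asymptotic converse -/

section AsymptoticConverse

variable {X Y₁ Y₂ : Type*} [Fintype X] [Fintype Y₁] [Fintype Y₂]

theorem probGuess_le_one {A : Type*} [Fintype A] {p : A → ℝ} (hp : p ∈ stdSimplex ℝ A) {n : ℕ}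
    (g : (Fin n → A) → Fin 2) (h : Fin 2) : probGuess p g h ≤ 1 := by
  rw [← (iid_mem_stdSimplex hp n).2]
  exact Finset.sum_le_univ_sum_of_nonneg (iid_nonneg hp.1 n)

/-- Single-letter bounds on the rate and the exponents of one code of blocklength `n`. -/
theorem Code.exists_mem_infoSet {n : ℕ} (c : Code X Y₁ Y₂ n) {w : X → ℝ} {K : X → Y₁ × Y₂ → ℝ}
    (hw : w ∈ stdSimplex ℝ X) (hK : ∀ x, K x ∈ stdSimplex ℝ (Y₁ × Y₂)) :
    ∃ t ∈ infoSet w (fun x => margFst (K x)) (fun x => margSnd (K x)),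
      n * t.1 ≤ Real.log c.W₁ ∧
      (c.alpha₁ ![compProd w K, indepLaw (compProd w K)] 1 < 1 →
        0 < c.beta₁ ![compProd w K, indepLaw (compProd w K)] 1 ∧
        (1 - c.alpha₁ ![compProd w K, indepLaw (compProd w K)] 1)
            * -Real.log (c.beta₁ ![compProd w K, indepLaw (compProd w K)] 1)
          ≤ n * t.2.1 + Real.log 2) ∧
      (c.alpha₂ ![compProd w K, indepLaw (compProd w K)] < 1 →
        0 < c.beta₂ ![compProd w K, indepLaw (compProd w K)] ∧
        (1 - c.alpha₂ ![compProd w K, indepLaw (compProd w K)])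
            * -Real.log (c.beta₂ ![compProd w K, indepLaw (compProd w K)])
          ≤ n * t.2.1 + n * t.2.2 + Real.log c.W₂ + Real.log 2) := by
  have hP := compProd_mem_stdSimplex hw hK
  have hQ := indepLaw_mem_stdSimplex hP
  have hac := eq_zero_of_indepLaw_eq_zero hP
  obtain ⟨t, ht, h0, h1, h2⟩ := exists_mem_infoSet_of_block hw
    (fun x => margFst_mem_stdSimplex (hK x)) (fun x => margSnd_mem_stdSimplex (hK x)) n
    (c.msgLaw w) (push_nonneg _ (iid_nonneg hw.1 n)) (c.margSnd_msgLaw w)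
  have hg : ent (c.msgLaw w) = n * ent w := (ent_push_graph _ _).trans (ent_iid hw n)
  refine ⟨t, ht, ?_, fun hα => ?_, fun hα => ?_⟩
  · have := c.ent_margFst_msgLaw_le hw
    linarith
  · have h := probGuess_mul_neg_log_le hP hQ hac
      (fun s : Fin n → X × Y₁ × Y₂ => (c.enc₁ fun t => (s t).1, fun t => (s t).2.1))
      (fun z => c.dec₁ z.1 z.2) hα
    rw [c.kl_obs₁ hw hK] at h
    exact ⟨h.1, h.2.trans (by linarith)⟩
  · have h := probGuess_mul_neg_log_le hP hQ hac
      (fun s : Fin n → X × Y₁ × Y₂ => ((c.enc₁ fun t => (s t).1,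
          c.enc₂ (c.enc₁ fun t => (s t).1) fun t => (s t).2.1), fun t => (s t).2.2))
      (fun z => c.dec₂ z.1.1 z.1.2 z.2) hα
    have h' := c.kl_obs₂_le hw hK
    exact ⟨h.1, h.2.trans (by linarith)⟩

/-- An exponent of at least `θ` forces `β n < exp (-n (θ - ε))` for all large `n`. The hypothesis
`0 < β n` avoids the junk value of `Real.log` at `0`. -/
theorem eventually_lt_neg_log_of_le_errorExponent {β : ℕ → ℝ} {θ ε : ℝ} (hε : 0 < ε)
    (h : (θ : EReal) ≤ errorExponent β) :
    ∀ᶠ n : ℕ in atTop, 0 < β n → θ - ε < (n : ℝ)⁻¹ * -Real.log (β n) := by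
  have h1 : ((θ - ε : ℝ) : EReal) < errorExponent β :=
    lt_of_lt_of_le (by exact_mod_cast sub_lt_self θ hε) h
  filter_upwards [eventually_lt_of_lt_liminf h1] with n hn hβ
  rw [ENNReal.log_ofReal_of_pos hβ, ← EReal.coe_mul, ← EReal.coe_neg, EReal.coe_lt_coe_iff] at hn
  linarith

/-- Approximate form of the converse, read off from one code of large blocklength. -/
theorem exists_mem_infoSet_of_achievable {w : X → ℝ} {K : X → Y₁ × Y₂ → ℝ}
    (hw : w ∈ stdSimplex ℝ X) (hK : ∀ x, K x ∈ stdSimplex ℝ (Y₁ × Y₂)) {R₁ : ℝ} {θ : ℝ × ℝ}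
    (hθ : Achievable ![compProd w K, indepLaw (compProd w K)] 1 R₁ 0 θ) {ε : ℝ} (hε : 0 < ε)
    (hε1 : ε < 1) :
    ∃ t ∈ infoSet w (fun x => margFst (K x)) (fun x => margSnd (K x)),
      t.1 ≤ R₁ + ε ∧ (1 - ε) * (θ.1 - ε) ≤ t.2.1 + ε ∧
      (1 - ε) * (θ.2 - ε) ≤ t.2.1 + t.2.2 + 2 * ε := by
  obtain ⟨-, -, c, hα₁, hα₂, hβ₁, hβ₂, hW₁, hW₂⟩ := hθ
  have hε' : (0 : EReal) < (ε : ℝ) := by exact_mod_cast hε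
  have a1 := eventually_lt_of_limsup_lt (hα₁.trans_lt hε')
  have a2 := eventually_lt_of_limsup_lt (hα₂.trans_lt hε')
  have a3 := eventually_lt_of_limsup_lt
    (hW₁.trans_lt (by exact_mod_cast lt_add_of_pos_right R₁ hε : (R₁ : EReal) < (R₁ + ε : ℝ)))
  have a4 := eventually_lt_of_limsup_lt
    (hW₂.trans_lt (by exact_mod_cast hε : ((0 : ℝ) : EReal) < (ε : ℝ)))
  have a5 := eventually_lt_neg_log_of_le_errorExponent hε hβ₁
  have a6 := eventually_lt_neg_log_of_le_errorExponent hε hβ₂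
  have a7 : ∀ᶠ n : ℕ in atTop, Real.log 2 / ε ≤ n :=
    tendsto_natCast_atTop_atTop.eventually_ge_atTop _
  obtain ⟨n, h1, h2, h3, h4, h5, h6, h7, hn⟩ :=
    (a1.and (a2.and (a3.and (a4.and (a5.and (a6.and (a7.and
      (eventually_gt_atTop 0)))))))).exists
  have hn0 : (0 : ℝ) < n := by exact_mod_cast hn
  rw [EReal.coe_lt_coe_iff] at h1 h2 h3 h4
  rw [inv_mul_lt_iff₀ hn0] at h3 h4
  rw [div_le_iff₀ hε] at h7
  obtain ⟨t, ht, ht0, ht1, ht2⟩ := (c n).exists_mem_infoSet hw hK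
  have hP := compProd_mem_stdSimplex hw hK
  have hQ := indepLaw_mem_stdSimplex hP
  have hmul : ∀ {α β θ' : ℝ}, α < ε → 0 < β → β ≤ 1 → θ' - ε < (n : ℝ)⁻¹ * -Real.log β →
      n * ((1 - ε) * (θ' - ε)) ≤ (1 - α) * -Real.log β := by
    intro α β θ' hα hβ hβ1 h
    rw [lt_inv_mul_iff₀ hn0] at h
    have hl : 0 ≤ -Real.log β := by linarith [Real.log_nonpos hβ.le hβ1]
    nlinarith
  refine ⟨t, ht, ?_, ?_, ?_⟩
  · exact le_of_mul_le_mul_left (by linarith) hn0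
  · obtain ⟨hpos, hle⟩ := ht1 (h1.trans hε1)
    have := hmul h1 hpos (probGuess_le_one hQ _ _) (h5 hpos)
    exact le_of_mul_le_mul_left (by linarith) hn0
  · obtain ⟨hpos, hle⟩ := ht2 (h2.trans hε1)
    have := hmul h2 hpos (probGuess_le_one hQ _ _) (h6 hpos)
    exact le_of_mul_le_mul_left (by linarith) hn0

/-- Converse: compactness of the set of information triples turns the approximate bounds into exact
ones, on the whole closure of the achievable pairs. -/
theorem exists_mem_infoSet_of_mem_exponentsRegion {w : X → ℝ} {K : X → Y₁ × Y₂ → ℝ}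
    (hw : w ∈ stdSimplex ℝ X) (hK : ∀ x, K x ∈ stdSimplex ℝ (Y₁ × Y₂)) {R₁ : ℝ} {θ : ℝ × ℝ}
    (hθ : θ ∈ exponentsRegion ![compProd w K, indepLaw (compProd w K)] 1 R₁ 0) :
    0 ≤ θ.1 ∧ 0 ≤ θ.2 ∧ ∃ t ∈ infoSet w (fun x => margFst (K x)) (fun x => margSnd (K x)),
      t.1 ≤ R₁ ∧ θ.1 ≤ t.2.1 ∧ θ.2 ≤ t.2.1 + t.2.2 := by
  obtain ⟨θs, hθs, hlim⟩ := mem_closure_iff_seq_limit.1 hθ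
  have l1 : Tendsto (fun k => (θs k).1) atTop (𝓝 θ.1) := (continuous_fst.tendsto θ).comp hlim
  have l2 : Tendsto (fun k => (θs k).2) atTop (𝓝 θ.2) := (continuous_snd.tendsto θ).comp hlim
  refine ⟨ge_of_tendsto' l1 fun k => (hθs k).1, ge_of_tendsto' l2 fun k => (hθs k).2.1, ?_⟩
  have hε : ∀ k : ℕ, (0 : ℝ) < 1 / ((k : ℝ) + 2) ∧ (1 : ℝ) / ((k : ℝ) + 2) < 1 := fun k => by
    have : (0 : ℝ) ≤ k := k.cast_nonneg
    exact ⟨by positivity, by rw [div_lt_one (by positivity)]; linarith⟩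
  have lε : Tendsto (fun k : ℕ => (1 : ℝ) / ((k : ℝ) + 2)) atTop (𝓝 0) :=
    tendsto_const_nhds.div_atTop (tendsto_natCast_atTop_atTop.atTop_add tendsto_const_nhds)
  choose t ht h1 h2 h3 using fun k =>
    exists_mem_infoSet_of_achievable hw hK (hθs k) (hε k).1 (hε k).2
  obtain ⟨t₀, ht₀, φ, hφ, hlimt⟩ := isCompact_infoSet.tendsto_subseq ht
  have m0 : Tendsto (fun k => (t (φ k)).1) atTop (𝓝 t₀.1) := (continuous_fst.tendsto t₀).comp hlimt
  have m1 : Tendsto (fun k => (t (φ k)).2.1) atTop (𝓝 t₀.2.1) :=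
    ((continuous_fst.comp continuous_snd).tendsto t₀).comp hlimt
  have m2 : Tendsto (fun k => (t (φ k)).2.2) atTop (𝓝 t₀.2.2) :=
    ((continuous_snd.comp continuous_snd).tendsto t₀).comp hlimt
  have e := lε.comp hφ.tendsto_atTop
  have n1 := l1.comp hφ.tendsto_atTop
  have n2 := l2.comp hφ.tendsto_atTop
  refine ⟨t₀, ht₀, ?_, ?_, ?_⟩
  · simpa using le_of_tendsto_of_tendsto' m0 (tendsto_const_nhds.add e) fun k => h1 (φ k)
  · simpa using le_of_tendsto_of_tendsto' ((tendsto_const_nhds.sub e).mul (n1.sub e)) (m1.add e)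
      fun k => h2 (φ k)
  · simpa using le_of_tendsto_of_tendsto' ((tendsto_const_nhds.sub e).mul (n2.sub e))
      ((m1.add m2).add (tendsto_const_nhds.mul e)) fun k => h3 (φ k)

end AsymptoticConverse

/-! ### Covering by a random codebook -/

section Covering

variable {U X Y : Type*} [Fintype U] [Fintype X] [Fintype Y]

open Classical in
/-- Random coding: some codebook of `W` words is at least as good as `W` independent words of law
`Q` are on average. The words are chosen one at a time. -/
theorem exists_codebook {Q : U → ℝ} (hQ : Q ∈ stdSimplex ℝ U) (G : U → X → Prop) (W : ℕ) :
    ∀ w : X → ℝ, (∀ x, 0 ≤ w x) → ∃ c : Fin W → U,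
      ∑ x, (if ∀ m, ¬ G (c m) x then w x else 0)
        ≤ ∑ x, w x * (1 - ∑ u, if G u x then Q u else 0) ^ W := by
  induction W with
  | zero =>
    intro w _
    exact ⟨Fin.elim0, by simp⟩
  | succ W ih =>
    intro w hw
    set g : X → ℝ := fun x => 1 - ∑ u, if G u x then Q u else 0 with hg
    have hgQ : ∀ x, g x = ∑ u, Q u * if G u x then 0 else 1 := fun x => by
      have h1 : g x = (∑ u, Q u) - ∑ u, if G u x then Q u else 0 := by rw [hQ.2]
      rw [h1, ← Finset.sum_sub_distrib]
      exact Finset.sum_congr rfl fun u _ => by split_ifs <;> simp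
    set f : U → ℝ := fun u => ∑ x, (if G u x then 0 else w x) * g x ^ W with hf
    have havg : ∑ u, Q u * f u = ∑ x, w x * g x ^ (W + 1) := by
      simp only [hf, Finset.mul_sum]
      rw [Finset.sum_comm]
      refine Finset.sum_congr rfl fun x _ => ?_
      rw [pow_succ, hgQ x, Finset.mul_sum, Finset.mul_sum]
      exact Finset.sum_congr rfl fun u _ => by split_ifs <;> ring
    have hne : Nonempty U := by
      by_contra h
      rw [not_nonempty_iff] at h
      simpa using hQ.2
    obtain ⟨u₀, hu₀⟩ := Finite.exists_min f
    have hmin : f u₀ ≤ ∑ x, w x * g x ^ (W + 1) := by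
      rw [← havg]
      calc f u₀ = ∑ u, Q u * f u₀ := by rw [← Finset.sum_mul, hQ.2, one_mul]
        _ ≤ _ := Finset.sum_le_sum fun u _ => mul_le_mul_of_nonneg_left (hu₀ u) (hQ.1 u)
    obtain ⟨c, hc⟩ := ih (fun x => if G u₀ x then 0 else w x) fun x => by
      split_ifs
      exacts [le_rfl, hw x]
    refine ⟨Fin.cons u₀ c, le_trans (le_of_eq ?_) (hc.trans hmin)⟩
    refine Finset.sum_congr rfl fun x _ => ?_
    simp only [Fin.forall_fin_succ, Fin.cons_zero, Fin.cons_succ]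
    by_cases h : G u₀ x <;> simp [h]

/-- Comes from `1 - z ≤ exp (-z)` and the convexity of `exp` between `0` and `-W * e`. -/
theorem one_sub_pow_le {z s e : ℝ} (W : ℕ) (hz : z ≤ 1) (hs0 : 0 ≤ s) (hs1 : s ≤ 1)
    (hzs : e * s ≤ z) : (1 - z) ^ W ≤ 1 - s + Real.exp (-(W * e)) := by
  have h1 : (1 - z) ^ W ≤ Real.exp (-z) ^ W :=
    pow_le_pow_left₀ (by linarith) (by linarith [Real.add_one_le_exp (-z)]) W
  rw [← Real.exp_nat_mul] at h1
  have h2 : Real.exp (W * -z) ≤ Real.exp ((1 - s) * 0 + s * (-(W * e))) := by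
    apply Real.exp_le_exp.2
    have := mul_le_mul_of_nonneg_left hzs (Nat.cast_nonneg (α := ℝ) W)
    linarith
  have h3 := convexOn_exp.2 (Set.mem_univ (0 : ℝ)) (Set.mem_univ (-(W * e)))
    (sub_nonneg.2 hs1) hs0 (by ring)
  simp only [smul_eq_mul, Real.exp_zero, mul_one] at h3
  have h4 : s * Real.exp (-(W * e)) ≤ Real.exp (-(W * e)) :=
    mul_le_of_le_one_left (Real.exp_pos _).le hs1
  linarith

open Classical in
/-- Covering: if the density of `v` with respect to the product of its marginals is at most `exp a`
on `G`, then `W ≫ exp a` codewords suffice for the encoder to find, for most source symbols, a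
codeword related to it by `G`. -/
theorem exists_covering {v : U × X → ℝ} (hv : v ∈ stdSimplex ℝ (U × X)) (G : U → X → Prop) (a : ℝ)
    (hG : ∀ u x, G u x → v (u, x) ≤ Real.exp a * (margFst v u * margSnd v x)) {W : ℕ}
    (hW : 0 < W) :
    ∃ (c : Fin W → U) (enc : X → Fin W),
      ∑ x, margSnd v x * (if G (c (enc x)) x then 0 else 1)
        ≤ ∑ x, ∑ u, v (u, x) * (if G u x then 0 else 1) + Real.exp (-(W * Real.exp (-a))) := by
  set Q := margFst v with hQdef
  set P := margSnd v with hPdef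
  have hQ : Q ∈ stdSimplex ℝ U := margFst_mem_stdSimplex hv
  have hP : P ∈ stdSimplex ℝ X := margSnd_mem_stdSimplex hv
  obtain ⟨c, hc⟩ := exists_codebook hQ G W P hP.1
  refine ⟨c, fun x => if h : ∃ m, G (c m) x then h.choose else ⟨0, hW⟩, ?_⟩
  refine le_trans (le_of_eq (Finset.sum_congr rfl fun x _ => ?_)) (hc.trans ?_)
  · by_cases h : ∃ m, G (c m) x
    · have h' : ¬ ∀ m, ¬ G (c m) x := by simpa using h
      simp only [dif_pos h, if_pos h.choose_spec, if_neg h', mul_zero]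
    · have h' : ∀ m, ¬ G (c m) x := by simpa using h
      simp only [dif_neg h, if_neg (h' _), if_pos h', mul_one]
  · have key : ∀ x, P x * (1 - ∑ u, if G u x then Q u else 0) ^ W
        ≤ ∑ u, v (u, x) * (if G u x then 0 else 1) + P x * Real.exp (-(W * Real.exp (-a))) := by
      intro x
      rcases (hP.1 x).eq_or_lt with h0 | hpos
      · rw [← h0, zero_mul, zero_mul, add_zero]
        exact Finset.sum_nonneg fun u _ => mul_nonneg (hv.1 _) (by split_ifs <;> norm_num)
      -- the conditional probability of the set `G` given `x`
      set s := (∑ u, if G u x then v (u, x) else 0) / P x with hs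
      have hsP : s * P x = ∑ u, if G u x then v (u, x) else 0 := div_mul_cancel₀ _ hpos.ne'
      have hsum : (∑ u, if G u x then v (u, x) else 0)
          + ∑ u, v (u, x) * (if G u x then 0 else 1) = P x := by
        rw [← Finset.sum_add_distrib]
        exact Finset.sum_congr rfl fun u _ => by split_ifs <;> simp
      have hn0 : 0 ≤ ∑ u, if G u x then v (u, x) else 0 :=
        Finset.sum_nonneg fun u _ => by split_ifs; exacts [hv.1 _, le_rfl]
      have hn1 : 0 ≤ ∑ u, v (u, x) * (if G u x then 0 else 1) :=
        Finset.sum_nonneg fun u _ => mul_nonneg (hv.1 _) (by split_ifs <;> norm_num)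
      have hz1 : (∑ u, if G u x then Q u else 0) ≤ 1 := by
        rw [← hQ.2]
        exact Finset.sum_le_sum fun u _ => by split_ifs; exacts [le_rfl, hQ.1 u]
      have hzs : Real.exp (-a) * s ≤ ∑ u, if G u x then Q u else 0 := by
        refine le_of_mul_le_mul_right ?_ hpos
        rw [mul_assoc, hsP, Finset.mul_sum, Finset.sum_mul]
        refine Finset.sum_le_sum fun u _ => ?_
        split_ifs with h
        · have := mul_le_mul_of_nonneg_left (hG u x h) (Real.exp_pos (-a)).le
          rwa [← mul_assoc, ← Real.exp_add, neg_add_cancel, Real.exp_zero, one_mul] at this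
        · simp
      have h := one_sub_pow_le W hz1 (div_nonneg hn0 hpos.le)
        ((div_le_one hpos).2 (by linarith)) hzs
      have h' := mul_le_mul_of_nonneg_left h hpos.le
      have : P x * (1 - s + Real.exp (-(W * Real.exp (-a))))
          = (P x - s * P x) + P x * Real.exp (-(W * Real.exp (-a))) := by ring
      rw [this, hsP] at h'
      linarith
    refine (Finset.sum_le_sum fun x _ => key x).trans (le_of_eq ?_)
    rw [Finset.sum_add_distrib, ← Finset.sum_mul, hP.2, one_mul]

open Classical in
/-- Covering for a noisy observation: the codeword chosen by the encoder and the channel output `Y`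
rarely satisfy `bad`, provided that `bad` is unlikely under the joint law. -/
theorem exists_covering_channel {v : U × X → ℝ} (hv : v ∈ stdSimplex ℝ (U × X)) {K : X → Y → ℝ}
    (hK : ∀ x, K x ∈ stdSimplex ℝ Y) (bad : U → Y → Prop) (a : ℝ) {δ : ℝ} (hδ : 0 < δ) {W : ℕ}
    (hW : 0 < W) :
    ∃ (c : Fin W → U) (enc : X → Fin W),
      ∑ x, margSnd v x * ∑ y, K x y * (if bad (c (enc x)) y then 1 else 0)
        ≤ δ + (∑ ux, v ux * if v ux ≤ Real.exp a * (margFst v ux.1 * margSnd v ux.2) then 0 else 1)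
          + (∑ ux, v ux * ∑ y, K ux.2 y * (if bad ux.1 y then 1 else 0)) / δ
          + Real.exp (-(W * Real.exp (-a))) := by
  set b : U → X → ℝ := fun u x => ∑ y, K x y * (if bad u y then 1 else 0) with hb
  have hb0 : ∀ u x, 0 ≤ b u x := fun u x =>
    Finset.sum_nonneg fun y _ => mul_nonneg ((hK x).1 y) (by split_ifs <;> norm_num)
  have hb1 : ∀ u x, b u x ≤ 1 := fun u x => by
    rw [← (hK x).2]
    refine Finset.sum_le_sum fun y _ => mul_le_of_le_one_right ((hK x).1 y) ?_
    split_ifs <;> norm_num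
  -- the second clause keeps the pairs for which `bad` is conditionally unlikely
  obtain ⟨G, hG⟩ : ∃ G : U → X → Prop, ∀ u x, G u x ↔
      v (u, x) ≤ Real.exp a * (margFst v u * margSnd v x) ∧ b u x ≤ δ := ⟨_, fun _ _ => Iff.rfl⟩
  obtain ⟨c, enc, h⟩ := exists_covering hv G a (fun u x h => ((hG u x).1 h).1) hW
  refine ⟨c, enc, ?_⟩
  have hP := margSnd_mem_stdSimplex hv
  have h1 : ∑ x, margSnd v x * b (c (enc x)) x
      ≤ δ + ∑ x, margSnd v x * (if G (c (enc x)) x then 0 else 1) := by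
    calc ∑ x, margSnd v x * b (c (enc x)) x
        ≤ ∑ x, (margSnd v x * δ + margSnd v x * (if G (c (enc x)) x then 0 else 1)) := by
          refine Finset.sum_le_sum fun x _ => ?_
          rw [← mul_add]
          refine mul_le_mul_of_nonneg_left ?_ (hP.1 x)
          split_ifs with hg
          · linarith [((hG _ _).1 hg).2]
          · linarith [hb1 (c (enc x)) x]
      _ = _ := by rw [Finset.sum_add_distrib, ← Finset.sum_mul, hP.2, one_mul]
  have h2 : ∑ x, ∑ u, v (u, x) * (if G u x then 0 else 1)
      ≤ (∑ ux, v ux * if v ux ≤ Real.exp a * (margFst v ux.1 * margSnd v ux.2) then 0 else 1)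
        + (∑ ux, v ux * b ux.1 ux.2) / δ := by
    rw [Finset.sum_div, ← Finset.sum_add_distrib, Fintype.sum_prod_type_right]
    refine Finset.sum_le_sum fun x _ => Finset.sum_le_sum fun u _ => ?_
    rw [mul_div_assoc, ← mul_add]
    refine mul_le_mul_of_nonneg_left ?_ (hv.1 _)
    have hq : 0 ≤ b u x / δ := div_nonneg (hb0 u x) hδ.le
    by_cases hr : v (u, x) ≤ Real.exp a * (margFst v u * margSnd v x)
    · by_cases hbd : b u x ≤ δ
      · rw [if_pos ((hG u x).2 ⟨hr, hbd⟩), if_pos hr]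
        linarith
      · rw [if_neg fun hg => hbd ((hG u x).1 hg).2, if_pos hr, zero_add]
        exact (one_le_div hδ).2 (not_le.1 hbd).le
    · rw [if_neg fun hg => hr ((hG u x).1 hg).1, if_neg hr]
      linarith
  change ∑ x, margSnd v x * b (c (enc x)) x ≤ δ + _ + (∑ ux, v ux * b ux.1 ux.2) / δ + _
  linarith

end Covering

/-! ### Typicality -/

section Typicality

variable {A : Type*} [Fintype A]

theorem sum_iid_mul_sum {p : A → ℝ} (hp : p ∈ stdSimplex ℝ A) {g : A → ℝ}
    (hg : ∑ a, p a * g a = 0) (n : ℕ) : ∑ s, iid p n s * ∑ t, g (s t) = 0 := by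
  induction n with
  | zero => simp
  | succ n ih =>
    rw [sum_cons]
    simp only [iid_cons, Fin.sum_univ_succ, Fin.cons_zero, Fin.cons_succ]
    calc _ = ∑ a, (p a * g a * (∑ s, iid p n s) + p a * ∑ s, iid p n s * ∑ t, g (s t)) := by
          refine Finset.sum_congr rfl fun a _ => ?_
          rw [Finset.mul_sum, Finset.mul_sum, ← Finset.sum_add_distrib]
          exact Finset.sum_congr rfl fun s _ => by ring
      _ = 0 := by simp only [ih, (iid_mem_stdSimplex hp n).2, mul_one, mul_zero, add_zero, hg]

/-- The variance of a sum of independent centred variables. -/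
theorem sum_iid_mul_sum_sq {p : A → ℝ} (hp : p ∈ stdSimplex ℝ A) {g : A → ℝ}
    (hg : ∑ a, p a * g a = 0) (n : ℕ) :
    ∑ s, iid p n s * (∑ t, g (s t)) ^ 2 = n * ∑ a, p a * g a ^ 2 := by
  induction n with
  | zero => simp
  | succ n ih =>
    rw [sum_cons]
    simp only [iid_cons, Fin.sum_univ_succ, Fin.cons_zero, Fin.cons_succ]
    calc _ = ∑ a, (p a * g a ^ 2 * (∑ s, iid p n s)
            + 2 * (p a * g a) * (∑ s, iid p n s * ∑ t, g (s t))
            + p a * ∑ s, iid p n s * (∑ t, g (s t)) ^ 2) := by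
          refine Finset.sum_congr rfl fun a _ => ?_
          rw [Finset.mul_sum, Finset.mul_sum, Finset.mul_sum, ← Finset.sum_add_distrib,
            ← Finset.sum_add_distrib]
          exact Finset.sum_congr rfl fun s _ => by ring
      _ = _ := by
          simp only [ih, (iid_mem_stdSimplex hp n).2, sum_iid_mul_sum hp hg, mul_one, mul_zero,
            add_zero, Finset.sum_add_distrib, ← Finset.sum_mul, hp.2, one_mul]
          push_cast
          ring

open Classical in
/-- Asymptotic equipartition: a product of `n` independent copies of `r` concentrates around the
exponential of its mean logarithm. -/
theorem exists_typicality_bound {q : A → ℝ} (hq : q ∈ stdSimplex ℝ A) {r : A → ℝ}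
    (hr : ∀ a, q a ≠ 0 → 0 < r a) {μ : ℝ} (hμ : ∑ a, q a * Real.log (r a) = μ) {ε : ℝ}
    (hε : 0 < ε) :
    ∃ C : ℝ, ∀ n : ℕ, 0 < n →
      ∑ s : Fin n → A, iid q n s * (if Real.exp (n * (μ - ε)) ≤ ∏ t, r (s t) ∧
        ∏ t, r (s t) ≤ Real.exp (n * (μ + ε)) then 0 else 1) ≤ C / n := by
  -- Chebyshev's inequality for the centred log-ratio `g`
  set g : A → ℝ := fun a => Real.log (r a) - μ with hgdef
  have hg : ∑ a, q a * g a = 0 := by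
    simp only [hgdef, mul_sub, Finset.sum_sub_distrib, ← Finset.sum_mul, hq.2, hμ, one_mul, sub_self]
  refine ⟨(∑ a, q a * g a ^ 2) / ε ^ 2, fun n hn => ?_⟩
  have hn0 : (0 : ℝ) < n := by exact_mod_cast hn
  have hden : (0 : ℝ) < (n * ε) ^ 2 := by positivity
  have h := sum_iid_mul_sum_sq hq hg n
  have hC : (∑ a, q a * g a ^ 2) / ε ^ 2 / n
      = (∑ s, iid q n s * (∑ t, g (s t)) ^ 2) / (n * ε) ^ 2 := by
    rw [h]
    field_simp
  rw [hC, Finset.sum_div]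
  refine Finset.sum_le_sum fun s _ => ?_
  have hs0 := iid_nonneg hq.1 n s
  split_ifs with hT
  · rw [mul_zero]
    positivity
  · rw [mul_one, mul_div_assoc]
    by_cases hz : iid q n s = 0
    · rw [hz, zero_mul]
    refine le_mul_of_one_le_right hs0 ((one_le_div hden).2 ?_)
    have hpos : ∀ t, 0 < r (s t) := fun t =>
      hr _ fun h0 => hz (Finset.prod_eq_zero (Finset.mem_univ t) h0)
    have hsum : ∑ t, g (s t) = Real.log (∏ t, r (s t)) - n * μ := by
      rw [Real.log_prod fun t _ => (hpos t).ne']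
      simp [hgdef]
    have hprod : 0 < ∏ t, r (s t) := Finset.prod_pos fun t _ => hpos t
    rw [← Real.le_log_iff_exp_le hprod, ← Real.log_le_iff_le_exp hprod] at hT
    rw [hsum, sq_le_sq, abs_of_pos (by positivity)]
    by_contra hlt
    rw [not_le, abs_lt] at hlt
    exact hT ⟨by linarith [hlt.1], by linarith [hlt.2]⟩

end Typicality

/-! ### Likelihood ratios -/

section Ratio

variable {A B : Type*} [Fintype A] [Fintype B]

/-- Density of a joint law with respect to the product of its marginals. -/
noncomputable def infoRatio (p : A × B → ℝ) (ab : A × B) : ℝ :=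
  p ab / (margFst p ab.1 * margSnd p ab.2)

theorem eq_infoRatio_mul {p : A × B → ℝ} (hp : ∀ x, 0 ≤ p x) (ab : A × B) :
    p ab = infoRatio p ab * (margFst p ab.1 * margSnd p ab.2) := by
  by_cases h : margFst p ab.1 * margSnd p ab.2 = 0
  · rw [h, mul_zero]
    rcases mul_eq_zero.1 h with h | h
    · exact eq_zero_of_margFst_eq_zero hp h ab.2
    · exact eq_zero_of_margSnd_eq_zero hp h ab.1
  · exact (div_mul_cancel₀ _ h).symm

theorem infoRatio_pos {p : A × B → ℝ} (hp : ∀ x, 0 ≤ p x) {ab : A × B} (h : p ab ≠ 0) :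
    0 < infoRatio p ab := by
  refine (div_nonneg (hp ab) (mul_nonneg (margFst_nonneg hp _) (margSnd_nonneg hp _))).lt_of_ne ?_
  intro h0
  exact h (by rw [eq_infoRatio_mul hp ab, infoRatio, ← h0, zero_mul])

theorem sum_mul_log_infoRatio (p : A × B → ℝ) :
    ∑ ab, p ab * Real.log (infoRatio p ab) = mutualInfo p := by
  simp only [Fintype.sum_prod_type, mutualInfo, infoRatio]

theorem sum_margSnd_mul_infoRatio_le {p : A × B → ℝ} (hp : ∀ x, 0 ≤ p x) (a : A) :
    ∑ b, margSnd p b * infoRatio p (a, b) ≤ 1 := by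
  calc ∑ b, margSnd p b * infoRatio p (a, b) ≤ ∑ b, p (a, b) / margFst p a := by
        refine Finset.sum_le_sum fun b _ => ?_
        by_cases h : margSnd p b = 0
        · rw [h, zero_mul]
          exact div_nonneg (hp _) (margFst_nonneg hp _)
        · simp only [infoRatio]
          rw [mul_comm (margFst p a), ← div_div, mul_div_assoc', mul_div_cancel₀ _ h]
    _ ≤ 1 := by
        rw [← Finset.sum_div]
        exact div_self_le_one _

open Classical in
/-- Under independence, the likelihood ratio with respect to a fixed codeword rarely exceeds
`exp τ`. -/
theorem sum_iid_infoRatio_le {p : A × B → ℝ} (hp : ∀ x, 0 ≤ p x) {n : ℕ} (u : Fin n → A) (τ : ℝ) :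
    ∑ y : Fin n → B, iid (margSnd p) n y * (if Real.exp τ ≤ ∏ t, infoRatio p (u t, y t) then 1 else 0)
      ≤ Real.exp (-τ) := by
  have hr0 : ∀ a, 0 ≤ infoRatio p a := fun a =>
    div_nonneg (hp a) (mul_nonneg (margFst_nonneg hp _) (margSnd_nonneg hp _))
  calc _ ≤ ∑ y : Fin n → B, Real.exp (-τ) * ∏ t, margSnd p (y t) * infoRatio p (u t, y t) := by
        refine Finset.sum_le_sum fun y _ => ?_
        have h0 := iid_nonneg (margSnd_nonneg hp) n y
        have h1 : 0 ≤ ∏ t, infoRatio p (u t, y t) := Finset.prod_nonneg fun t _ => hr0 _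
        rw [Finset.prod_mul_distrib]
        change _ ≤ Real.exp (-τ) * (iid (margSnd p) n y * _)
        rw [mul_left_comm]
        refine mul_le_mul_of_nonneg_left ?_ h0
        split_ifs with h
        · have := mul_le_mul_of_nonneg_left h (Real.exp_pos (-τ)).le
          rwa [← Real.exp_add, neg_add_cancel, Real.exp_zero] at this
        · positivity
    _ ≤ Real.exp (-τ) := by
        rw [← Finset.mul_sum,
          sum_prod_apply n fun t b => margSnd p b * infoRatio p (u t, b)]
        refine mul_le_of_le_one_right (Real.exp_pos _).le (Finset.prod_le_one (fun t _ => ?_) ?_)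
        · exact Finset.sum_nonneg fun b _ => mul_nonneg (margSnd_nonneg hp b) (hr0 _)
        · exact fun t _ => sum_margSnd_mul_infoRatio_le hp (u t)

/-- Joint law of a pair of blocks of independent pairs. -/
def iidPair (p : A × B → ℝ) (n : ℕ) (s : (Fin n → A) × (Fin n → B)) : ℝ :=
  iid p n fun t => (s.1 t, s.2 t)

/-- Sums over sequences of pairs as sums over pairs of sequences. -/
theorem sum_pair (n : ℕ) (F : (Fin n → A × B) → ℝ) :
    ∑ s, F s = ∑ a : (Fin n → A) × (Fin n → B), F fun t => (a.1 t, a.2 t) :=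
  ((Equiv.arrowProdEquivProdArrow (Fin n) (fun _ => A) fun _ => B).symm.sum_comp F).symm

theorem iidPair_mem_stdSimplex {p : A × B → ℝ} (hp : p ∈ stdSimplex ℝ (A × B)) (n : ℕ) :
    iidPair p n ∈ stdSimplex ℝ ((Fin n → A) × (Fin n → B)) :=
  ⟨fun _ => iid_nonneg hp.1 n _, by
    rw [← (iid_mem_stdSimplex hp n).2, sum_pair]
    rfl⟩

omit [Fintype A] in
theorem margFst_iidPair (p : A × B → ℝ) (n : ℕ) : margFst (iidPair p n) = iid (margFst p) n := by
  funext u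
  exact sum_prod_apply n fun t b => p (u t, b)

omit [Fintype B] in
theorem margSnd_iidPair (p : A × B → ℝ) (n : ℕ) : margSnd (iidPair p n) = iid (margSnd p) n := by
  funext y
  exact sum_prod_apply n fun t a => p (a, y t)

theorem iidPair_compProd {A B : Type*} (w : A → ℝ) (K : A → B → ℝ) (n : ℕ) (x : Fin n → A)
    (y : Fin n → B) : iidPair (compProd w K) n (x, y) = iid w n x * iidKer K n x y := by
  simp only [iidPair, iid, iidKer, compProd, Finset.prod_mul_distrib]

end Ratio

section DecisionRegions

variable {U X Y₁ Y₂ : Type*} [Fintype U] [Fintype X] [Fintype Y₁] [Fintype Y₂]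

theorem sum_compProd_fst (v : U × X → ℝ) (K : X → Y₁ × Y₂ → ℝ) (F : U × Y₁ → ℝ) :
    ∑ a, compProd v (fun ux => K ux.2) a * F (a.1.1, a.2.1)
      = ∑ b, outputSnd (fun x => margFst (K x)) v b * F b := by
  simp only [Fintype.sum_prod_type, compProd, outputSnd, margFst, Finset.mul_sum, Finset.sum_mul]
  exact Finset.sum_congr rfl fun u _ => Finset.sum_comm

theorem sum_compProd_snd (v : U × X → ℝ) (K : X → Y₁ × Y₂ → ℝ) (F : U × Y₂ → ℝ) :
    ∑ a, compProd v (fun ux => K ux.2) a * F (a.1.1, a.2.2)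
      = ∑ b, outputSnd (fun x => margSnd (K x)) v b * F b := by
  simp only [Fintype.sum_prod_type, compProd, outputSnd, margSnd, Finset.mul_sum, Finset.sum_mul]
  refine Finset.sum_congr rfl fun u _ => ?_
  rw [Finset.sum_comm (s := (Finset.univ : Finset Y₂))]
  exact Finset.sum_congr rfl fun x _ => Finset.sum_comm

omit [Fintype U] [Fintype Y₁] in
theorem outputSnd_margFst_ne_zero {v : U × X → ℝ} (hv : ∀ a, 0 ≤ v a) {K : X → Y₁ × Y₂ → ℝ}
    (hK : ∀ x y, 0 ≤ K x y) {a : (U × X) × (Y₁ × Y₂)}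
    (h : compProd v (fun ux => K ux.2) a ≠ 0) :
    outputSnd (fun x => margFst (K x)) v (a.1.1, a.2.1) ≠ 0 := by
  obtain ⟨⟨u, x⟩, y₁, y₂⟩ := a
  intro h0
  have h1 := (Finset.sum_eq_zero_iff_of_nonneg fun x _ =>
    mul_nonneg (hv (u, x)) (margFst_nonneg (hK x) y₁)).1 h0 x (Finset.mem_univ x)
  rcases mul_eq_zero.1 h1 with h1 | h1
  · exact h (by simp [compProd, h1])
  · exact h (by simp [compProd, eq_zero_of_margFst_eq_zero (hK x) h1 y₂])

omit [Fintype U] [Fintype Y₂] in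
theorem outputSnd_margSnd_ne_zero {v : U × X → ℝ} (hv : ∀ a, 0 ≤ v a) {K : X → Y₁ × Y₂ → ℝ}
    (hK : ∀ x y, 0 ≤ K x y) {a : (U × X) × (Y₁ × Y₂)}
    (h : compProd v (fun ux => K ux.2) a ≠ 0) :
    outputSnd (fun x => margSnd (K x)) v (a.1.1, a.2.2) ≠ 0 := by
  obtain ⟨⟨u, x⟩, y₁, y₂⟩ := a
  intro h0
  have h1 := (Finset.sum_eq_zero_iff_of_nonneg fun x _ =>
    mul_nonneg (hv (u, x)) (margSnd_nonneg (hK x) y₂)).1 h0 x (Finset.mem_univ x)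
  rcases mul_eq_zero.1 h1 with h1 | h1
  · exact h (by simp [compProd, h1])
  · exact h (by simp [compProd, eq_zero_of_margSnd_eq_zero (hK x) h1 y₁])

/-! ### The code -/

open Classical in
/-- Acceptance (value `0`) when the likelihood ratio of the codeword `u` and the block `y` is at
least `exp τ`. -/
noncomputable def ratioTest {A B : Type*} [Fintype A] [Fintype B] (p : A × B → ℝ) {n : ℕ} (τ : ℝ)
    (u : Fin n → A) (y : Fin n → B) : Fin 2 :=
  if Real.exp τ ≤ ∏ t, infoRatio p (u t, y t) then 0 else 1

/-- The code given by a codebook and a quantizer: Detector 1 runs a likelihood-ratio test and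
forwards its decision, and Detector 2 accepts when Detector 1 and its own likelihood-ratio test
do. -/
noncomputable def quantizeCode {n W : ℕ} (c : Fin W → Fin n → U) (enc : (Fin n → X) → Fin W)
    (p₁ : U × Y₁ → ℝ) (p₂ : U × Y₂ → ℝ) (τ₁ τ₂ : ℝ) : Code X Y₁ Y₂ n where
  W₁ := W
  W₂ := 2
  enc₁ := enc
  enc₂ m y := ratioTest p₁ τ₁ (c m) y
  dec₁ m y := ratioTest p₁ τ₁ (c m) y
  dec₂ m k y := if k = 0 ∧ ratioTest p₂ τ₂ (c m) y = 0 then 0 else 1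

variable {n W : ℕ} {c : Fin W → Fin n → U} {enc : (Fin n → X) → Fin W} {p₁ : U × Y₁ → ℝ}
  {p₂ : U × Y₂ → ℝ} {τ₁ τ₂ : ℝ}

theorem ratioTest_eq_one_iff {A B : Type*} [Fintype A] [Fintype B] {p : A × B → ℝ} {n : ℕ} {τ : ℝ}
    {u : Fin n → A} {y : Fin n → B} :
    ratioTest p τ u y = 1 ↔ ¬ Real.exp τ ≤ ∏ t, infoRatio p (u t, y t) := by
  unfold ratioTest
  split_ifs with h <;> simp [h]

theorem ratioTest_eq_zero_iff {A B : Type*} [Fintype A] [Fintype B] {p : A × B → ℝ} {n : ℕ} {τ : ℝ}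
    {u : Fin n → A} {y : Fin n → B} :
    ratioTest p τ u y = 0 ↔ Real.exp τ ≤ ∏ t, infoRatio p (u t, y t) := by
  unfold ratioTest
  split_ifs with h <;> simp [h]

open Classical in
/-- Error of the first kind in terms of the channel from the source block to the outputs. -/
theorem probGuess_le_of_imp {w : X → ℝ} (hw : ∀ x, 0 ≤ w x) {K : X → Y₁ × Y₂ → ℝ}
    (hK : ∀ x y, 0 ≤ K x y) (g : (Fin n → X × Y₁ × Y₂) → Fin 2)
    (bad : (Fin n → X) → (Fin n → Y₁ × Y₂) → Prop)
    (h : ∀ x y, g (fun t => (x t, y t)) = 1 → bad x y) :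
    probGuess (compProd w K) g 1
      ≤ ∑ x, iid w n x * ∑ y, iidKer K n x y * (if bad x y then 1 else 0) := by
  rw [probGuess, Finset.sum_filter, sum_pair, Fintype.sum_prod_type]
  refine Finset.sum_le_sum fun x _ => ?_
  rw [Finset.mul_sum]
  refine Finset.sum_le_sum fun y _ => ?_
  have h0 : 0 ≤ iid w n x * iidKer K n x y :=
    mul_nonneg (iid_nonneg hw n x) (Finset.prod_nonneg fun _ _ => hK _ _)
  have e : ∏ t, compProd w K (x t, y t) = iid w n x * iidKer K n x y := iidPair_compProd w K n x y
  by_cases hg : g (fun t => (x t, y t)) = 1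
  · rw [if_pos hg, if_pos (h x y hg), mul_one]
    exact e.le
  · rw [if_neg hg, ← mul_assoc]
    exact mul_nonneg h0 (by split_ifs <;> norm_num)

open Classical in
/-- Errors of the second kind under the hypothesis of independence: both tests are independent given
the codeword. -/
theorem probGuess_indepLaw_le {P : X × Y₁ × Y₂ → ℝ} (hP : P ∈ stdSimplex ℝ (X × Y₁ × Y₂))
    (g : (Fin n → X × Y₁ × Y₂) → Fin 2) (S₁ : (Fin n → X) → (Fin n → Y₁) → Prop)
    (S₂ : (Fin n → X) → (Fin n → Y₂) → Prop)
    (h : ∀ x y₁ y₂, g (fun t => (x t, y₁ t, y₂ t)) = 0 → S₁ x y₁ ∧ S₂ x y₂) {b₁ b₂ : ℝ}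
    (h₁ : ∀ x, ∑ y, iid (margFst (margSnd P)) n y * (if S₁ x y then 1 else 0) ≤ b₁)
    (h₂ : ∀ x, ∑ y, iid (margSnd (margSnd P)) n y * (if S₂ x y then 1 else 0) ≤ b₂)
    (hb₁ : 0 ≤ b₁) : probGuess (indepLaw P) g 0 ≤ b₁ * b₂ := by
  have hX := iid_mem_stdSimplex (margFst_mem_stdSimplex hP) n
  have hY₁ := iid_mem_stdSimplex (margFst_mem_stdSimplex (margSnd_mem_stdSimplex hP)) n
  have hY₂ := iid_mem_stdSimplex (margSnd_mem_stdSimplex (margSnd_mem_stdSimplex hP)) n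
  have hind : ∀ (p : Prop) [Decidable p], (0 : ℝ) ≤ if p then 1 else 0 := fun p _ => by
    split_ifs <;> norm_num
  rw [probGuess, Finset.sum_filter, sum_triple]
  calc _ ≤ ∑ x, ∑ y₁, ∑ y₂, iid (margFst P) n x *
          ((iid (margFst (margSnd P)) n y₁ * (if S₁ x y₁ then 1 else 0)) *
            (iid (margSnd (margSnd P)) n y₂ * (if S₂ x y₂ then 1 else 0))) := by
        refine Finset.sum_le_sum fun x _ => Finset.sum_le_sum fun y₁ _ =>
          Finset.sum_le_sum fun y₂ _ => ?_
        by_cases hg : g (fun t => (x t, y₁ t, y₂ t)) = 0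
        · obtain ⟨s₁, s₂⟩ := h x y₁ y₂ hg
          rw [if_pos hg, if_pos s₁, if_pos s₂, mul_one, mul_one]
          simp only [indepLaw, Finset.prod_mul_distrib, iid, mul_assoc]
          exact le_rfl
        · rw [if_neg hg]
          exact mul_nonneg (hX.1 x) (mul_nonneg (mul_nonneg (hY₁.1 _) (hind _))
            (mul_nonneg (hY₂.1 _) (hind _)))
    _ = ∑ x, iid (margFst P) n x *
          ((∑ y₁, iid (margFst (margSnd P)) n y₁ * (if S₁ x y₁ then 1 else 0)) *
            ∑ y₂, iid (margSnd (margSnd P)) n y₂ * (if S₂ x y₂ then 1 else 0)) := by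
        refine Finset.sum_congr rfl fun x _ => ?_
        rw [Finset.sum_mul_sum, Finset.mul_sum]
        exact Finset.sum_congr rfl fun y₁ _ => (Finset.mul_sum ..).symm
    _ ≤ ∑ x, iid (margFst P) n x * (b₁ * b₂) := by
        refine Finset.sum_le_sum fun x _ => mul_le_mul_of_nonneg_left ?_ (hX.1 x)
        exact mul_le_mul (h₁ x) (h₂ x)
          (Finset.sum_nonneg fun y _ => mul_nonneg (hY₂.1 _) (hind _)) hb₁
    _ = b₁ * b₂ := by rw [← Finset.sum_mul, hX.2, one_mul]

end DecisionRegions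

section Construction

variable {U X Y₁ Y₂ : Type*} [Fintype U] [Fintype X] [Fintype Y₁] [Fintype Y₂]

/-- Coding theorem at finite blocklength, with a free number `W` of codewords. The parameter `δ` is
the tolerated conditional probability, given the source block, that the chosen codeword fails to be
typical with the outputs; `C₀` and `C₁` come from Chebyshev's inequality. -/
theorem exists_code {v : U × X → ℝ} (hv : v ∈ stdSimplex ℝ (U × X)) {K : X → Y₁ × Y₂ → ℝ}
    (hK : ∀ x, K x ∈ stdSimplex ℝ (Y₁ × Y₂)) {ε : ℝ} (hε : 0 < ε) :
    ∃ C₀ C₁ : ℝ, ∀ n : ℕ, 0 < n → ∀ W : ℕ, 0 < W → ∀ δ : ℝ, 0 < δ →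
      ∃ c : Code X Y₁ Y₂ n, c.W₁ = W ∧ c.W₂ = 2 ∧
        c.alpha₁ ![compProd (margSnd v) K, indepLaw (compProd (margSnd v) K)] 1
          ≤ δ + C₀ / n + C₁ / n / δ + Real.exp (-(W * Real.exp (-(n * (mutualInfo v + ε))))) ∧
        c.alpha₂ ![compProd (margSnd v) K, indepLaw (compProd (margSnd v) K)]
          ≤ δ + C₀ / n + C₁ / n / δ + Real.exp (-(W * Real.exp (-(n * (mutualInfo v + ε))))) ∧
        c.beta₁ ![compProd (margSnd v) K, indepLaw (compProd (margSnd v) K)] 1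
          ≤ Real.exp (-(n * (mutualInfo (outputSnd (fun x => margFst (K x)) v) - ε))) ∧
        c.beta₂ ![compProd (margSnd v) K, indepLaw (compProd (margSnd v) K)]
          ≤ Real.exp (-(n * (mutualInfo (outputSnd (fun x => margFst (K x)) v) - ε)))
            * Real.exp (-(n * (mutualInfo (outputSnd (fun x => margSnd (K x)) v) - ε))) := by
  classical
  set w := margSnd v with hwdef
  have hw : w ∈ stdSimplex ℝ X := margSnd_mem_stdSimplex hv
  set v₁ := outputSnd (fun x => margFst (K x)) v with hv₁
  set v₂ := outputSnd (fun x => margSnd (K x)) v with hv₂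
  have hK0 : ∀ x y, 0 ≤ K x y := fun x => (hK x).1
  have hv₁0 : ∀ a, 0 ≤ v₁ a := outputSnd_nonneg (fun x => margFst_nonneg (hK0 x)) hv.1
  have hv₂0 : ∀ a, 0 ≤ v₂ a := outputSnd_nonneg (fun x => margSnd_nonneg (hK0 x)) hv.1
  set q : (U × X) × (Y₁ × Y₂) → ℝ := compProd v fun ux => K ux.2 with hqdef
  have hq : q ∈ stdSimplex ℝ _ := compProd_mem_stdSimplex hv fun ux => hK ux.2
  have hP : compProd w K ∈ stdSimplex ℝ _ := compProd_mem_stdSimplex hw hK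
  obtain ⟨C₀, hC₀⟩ := exists_typicality_bound hv (fun a ha => infoRatio_pos hv.1 ha)
    (sum_mul_log_infoRatio v) hε
  obtain ⟨C₁, hC₁⟩ := exists_typicality_bound hq (r := fun a => infoRatio v₁ (a.1.1, a.2.1))
    (fun a ha => infoRatio_pos hv₁0 (outputSnd_margFst_ne_zero hv.1 hK0 ha))
    ((sum_compProd_fst v K fun b => Real.log (infoRatio v₁ b)).trans (sum_mul_log_infoRatio v₁)) hε
  obtain ⟨C₂, hC₂⟩ := exists_typicality_bound hq (r := fun a => infoRatio v₂ (a.1.1, a.2.2))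
    (fun a ha => infoRatio_pos hv₂0 (outputSnd_margSnd_ne_zero hv.1 hK0 ha))
    ((sum_compProd_snd v K fun b => Real.log (infoRatio v₂ b)).trans (sum_mul_log_infoRatio v₂)) hε
  refine ⟨C₀, C₁ + C₂, fun n hn W hW δ hδ => ?_⟩
  have hvn := iidPair_mem_stdSimplex hv n
  set τ₁ : ℝ := n * (mutualInfo v₁ - ε) with hτ₁
  set τ₂ : ℝ := n * (mutualInfo v₂ - ε) with hτ₂
  obtain ⟨bad, hbad⟩ : ∃ bad : (Fin n → U) → (Fin n → Y₁ × Y₂) → Prop, ∀ u y, bad u y ↔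
      ¬ (Real.exp τ₁ ≤ ∏ t, infoRatio v₁ (u t, (y t).1)) ∨
      ¬ (Real.exp τ₂ ≤ ∏ t, infoRatio v₂ (u t, (y t).2)) := ⟨_, fun _ _ => Iff.rfl⟩
  obtain ⟨c, enc, hcov⟩ := exists_covering_channel hvn (iidKer_mem_stdSimplex hK n) bad
    (n * (mutualInfo v + ε)) hδ hW
  rw [margSnd_iidPair, margFst_iidPair] at hcov
  -- the quantization event
  have hb0 : ∑ ux, iidPair v n ux * (if iidPair v n ux ≤ Real.exp (n * (mutualInfo v + ε))
      * (iid (margFst v) n ux.1 * iid (margSnd v) n ux.2) then 0 else 1) ≤ C₀ / n := by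
    refine le_trans ?_ (hC₀ n hn)
    rw [sum_pair]
    refine Finset.sum_le_sum fun ux _ => mul_le_mul_of_nonneg_left ?_ (hvn.1 ux)
    have hfac : iidPair v n ux = (∏ t, infoRatio v (ux.1 t, ux.2 t))
        * (iid (margFst v) n ux.1 * iid (margSnd v) n ux.2) := by
      simp only [iidPair, iid, ← Finset.prod_mul_distrib]
      exact Finset.prod_congr rfl fun t _ => eq_infoRatio_mul hv.1 _
    have h0 : 0 ≤ iid (margFst v) n ux.1 * iid (margSnd v) n ux.2 :=
      mul_nonneg (iid_nonneg (margFst_nonneg hv.1) n _) (iid_nonneg (margSnd_nonneg hv.1) n _)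
    by_cases hT : Real.exp (n * (mutualInfo v - ε)) ≤ ∏ t, infoRatio v (ux.1 t, ux.2 t) ∧
        ∏ t, infoRatio v (ux.1 t, ux.2 t) ≤ Real.exp (n * (mutualInfo v + ε))
    · have hle : iidPair v n ux ≤ Real.exp (n * (mutualInfo v + ε))
          * (iid (margFst v) n ux.1 * iid (margSnd v) n ux.2) :=
        hfac.trans_le (mul_le_mul_of_nonneg_right hT.2 h0)
      rw [if_pos hle, if_pos hT]
    · rw [if_neg hT]
      split_ifs <;> norm_num
  -- the detection events
  have hb1 : ∑ ux, iidPair v n ux * ∑ y, iidKer K n ux.2 y * (if bad ux.1 y then 1 else 0)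
      ≤ (C₁ + C₂) / n := by
    have e : ∑ ux, iidPair v n ux * ∑ y, iidKer K n ux.2 y * (if bad ux.1 y then 1 else 0)
        = ∑ s, iid q n s * (if bad (fun t => (s t).1.1) (fun t => (s t).2) then 1 else 0) := by
      symm
      rw [sum_pair, Fintype.sum_prod_type, sum_pair]
      refine Finset.sum_congr rfl fun ux _ => ?_
      rw [Finset.mul_sum]
      refine Finset.sum_congr rfl fun y _ => ?_
      rw [← mul_assoc]
      congr 1
      exact iidPair_compProd v (fun ux => K ux.2) n _ y
    rw [e, add_div]
    refine le_trans ?_ (add_le_add (hC₁ n hn) (hC₂ n hn))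
    rw [← Finset.sum_add_distrib]
    refine Finset.sum_le_sum fun s _ => ?_
    rw [← mul_add]
    refine mul_le_mul_of_nonneg_left ?_ (iid_nonneg hq.1 n s)
    by_cases hb : bad (fun t => (s t).1.1) (fun t => (s t).2)
    · rw [if_pos hb]
      rcases (hbad _ _).1 hb with h | h
      · rw [if_neg fun h' => h h'.1]
        exact le_add_of_nonneg_right (by split_ifs <;> norm_num)
      · rw [if_neg (c := _ ∧ ∏ t, infoRatio v₂ _ ≤ _) fun h' => h h'.1]
        exact le_add_of_nonneg_left (by split_ifs <;> norm_num)
    · rw [if_neg hb]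
      exact add_nonneg (by split_ifs <;> norm_num) (by split_ifs <;> norm_num)
  have hα : ∀ g : (Fin n → X × Y₁ × Y₂) → Fin 2,
      (∀ x y, g (fun t => (x t, y t)) = 1 → bad (c (enc x)) y) →
      probGuess (compProd w K) g 1
        ≤ δ + C₀ / n + (C₁ + C₂) / n / δ
          + Real.exp (-(W * Real.exp (-(n * (mutualInfo v + ε))))) := by
    intro g hg
    refine (probGuess_le_of_imp hw.1 hK0 g (fun x y => bad (c (enc x)) y) hg).trans
      (hcov.trans ?_)
    have := div_le_div_of_nonneg_right hb1 hδ.le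
    linarith
  have hm₁ : margSnd v₁ = margFst (margSnd (compProd w K)) := by
    rw [hv₁, margSnd_outputSnd, margFst_margSnd_compProd]
  have hm₂ : margSnd v₂ = margSnd (margSnd (compProd w K)) := by
    rw [hv₂, margSnd_outputSnd, margSnd_margSnd_compProd]
  have t₁ := fun x => sum_iid_infoRatio_le hv₁0 (c (enc x)) τ₁
  have t₂ := fun x => sum_iid_infoRatio_le hv₂0 (c (enc x)) τ₂
  rw [hm₁] at t₁
  rw [hm₂] at t₂
  refine ⟨quantizeCode c enc v₁ v₂ τ₁ τ₂, rfl, rfl, hα _ fun x y h => ?_, hα _ fun x y h => ?_,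
    ?_, ?_⟩
  · exact (hbad _ _).2 (Or.inl (ratioTest_eq_one_iff.1 h))
  · rw [hbad]
    by_contra hcon
    rw [not_or, not_not, not_not] at hcon
    have h1 : ratioTest v₁ τ₁ (c (enc x)) (fun t => (y t).1) = 0 :=
      ratioTest_eq_zero_iff.2 hcon.1
    have h2 : ratioTest v₂ τ₂ (c (enc x)) (fun t => (y t).2) = 0 :=
      ratioTest_eq_zero_iff.2 hcon.2
    have h3 : (quantizeCode c enc v₁ v₂ τ₁ τ₂).guess₂ (fun t => (x t, y t)) = 0 := if_pos ⟨h1, h2⟩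
    rw [h3] at h
    exact absurd h (by decide)
  · have := probGuess_indepLaw_le hP (quantizeCode c enc v₁ v₂ τ₁ τ₂).guess₁
      (fun x y => Real.exp τ₁ ≤ ∏ t, infoRatio v₁ (c (enc x) t, y t)) (fun _ _ => True)
      (fun x y₁ y₂ h => ⟨ratioTest_eq_zero_iff.1 h, trivial⟩) t₁ (b₂ := 1)
      (fun x => by
        simp only [if_true, mul_one]
        exact (iid_mem_stdSimplex (margSnd_mem_stdSimplex (margSnd_mem_stdSimplex hP)) n).2.le)
      (Real.exp_pos _).le
    rwa [mul_one] at this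
  · refine probGuess_indepLaw_le hP (quantizeCode c enc v₁ v₂ τ₁ τ₂).guess₂
      (fun x y => Real.exp τ₁ ≤ ∏ t, infoRatio v₁ (c (enc x) t, y t))
      (fun x y => Real.exp τ₂ ≤ ∏ t, infoRatio v₂ (c (enc x) t, y t))
      (fun x y₁ y₂ h => ?_) t₁ t₂ (Real.exp_pos _).le
    by_contra hcon
    have h3 : (quantizeCode c enc v₁ v₂ τ₁ τ₂).guess₂ (fun t => (x t, y₁ t, y₂ t)) = 1 :=
      if_neg fun hh => hcon ⟨ratioTest_eq_zero_iff.1 hh.1, ratioTest_eq_zero_iff.1 hh.2⟩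
    rw [h3] at h
    exact absurd h (by decide)

end Construction

/-! ### Achievability -/

section Achievability

theorem le_errorExponent {β : ℕ → ℝ} {θ : ℝ} (h : ∀ n : ℕ, 0 < n → β n ≤ Real.exp (-(n * θ))) :
    (θ : EReal) ≤ errorExponent β := by
  refine le_liminf_of_le (by isBoundedDefault) ?_
  filter_upwards [eventually_gt_atTop 0] with n hn
  have hn0 : (0 : ℝ) < n := by exact_mod_cast hn
  have h1 : ENNReal.log (ENNReal.ofReal (β n)) ≤ ((-(n * θ) : ℝ) : EReal) := by
    refine (ENNReal.log_monotone (ENNReal.ofReal_le_ofReal (h n hn))).trans_eq ?_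
    rw [ENNReal.log_ofReal_of_pos (Real.exp_pos _), Real.log_exp]
  have h2 : (((n : ℝ)⁻¹ : ℝ) : EReal) * ENNReal.log (ENNReal.ofReal (β n))
      ≤ (((n : ℝ)⁻¹ : ℝ) : EReal) * ((-(n * θ) : ℝ) : EReal) :=
    mul_le_mul_of_nonneg_left h1 (by exact_mod_cast (inv_pos.2 hn0).le)
  rw [← EReal.coe_mul] at h2
  have h3 : (n : ℝ)⁻¹ * -(n * θ) = -θ := by
    field_simp
  rw [h3] at h2
  have h4 := EReal.neg_le_neg_iff.2 h2
  rwa [EReal.coe_neg, neg_neg] at h4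

theorem limsup_coe_le_zero {α b : ℕ → ℝ} (h : ∀ᶠ n in atTop, α n ≤ b n)
    (hb : Tendsto b atTop (𝓝 0)) : limsup (fun n => (α n : EReal)) atTop ≤ 0 := by
  have h1 : Tendsto (fun n => (b n : EReal)) atTop (𝓝 ((0 : ℝ) : EReal)) :=
    (continuous_coe_real_ereal.tendsto 0).comp hb
  have h2 : limsup (fun n => (α n : EReal)) atTop ≤ limsup (fun n => (b n : EReal)) atTop :=
    limsup_le_limsup (h.mono fun n hn => EReal.coe_le_coe_iff.2 hn)
  rw [h1.limsup_eq] at h2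
  exact h2

/-- The number of codewords at blocklength `n` for the rate `R`, as a multiple of the number needed
for covering. -/
theorem half_exp_le_floor {R a : ℝ} (hR : 0 ≤ R) (n : ℕ) :
    Real.exp (n * (R - a)) / 2 ≤ ⌊Real.exp (n * R)⌋₊ * Real.exp (-(n * a)) := by
  have h1 : 1 ≤ Real.exp (n * R) := Real.one_le_exp (by positivity)
  have h2 : Real.exp (n * R) / 2 ≤ ⌊Real.exp (n * R)⌋₊ := by
    have h3 := Nat.lt_floor_add_one (Real.exp (n * R))
    have h4 : (1 : ℝ) ≤ ⌊Real.exp (n * R)⌋₊ := by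
      exact_mod_cast Nat.le_floor (by simpa using h1)
    linarith
  have h5 := mul_le_mul_of_nonneg_right h2 (Real.exp_pos (-(n * a))).le
  refine le_trans (le_of_eq ?_) h5
  rw [div_mul_eq_mul_div, ← Real.exp_add]
  congr 2
  ring

variable {U X Y₁ Y₂ : Type*} [Fintype U] [Fintype X] [Fintype Y₁] [Fintype Y₂]

/-- Every test channel with `I(U;X) < R₁` gives exponents arbitrarily close to `I(U;Y₁)` and
`I(U;Y₁) + I(U;Y₂)`. -/
theorem achievable_of_mutualInfo_lt {v : U × X → ℝ} (hv : v ∈ stdSimplex ℝ (U × X))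
    {K : X → Y₁ × Y₂ → ℝ} (hK : ∀ x, K x ∈ stdSimplex ℝ (Y₁ × Y₂)) {R₁ ε : ℝ} (hR₁ : 0 < R₁)
    (hε : 0 < ε) (hI : mutualInfo v + ε < R₁) :
    Achievable ![compProd (margSnd v) K, indepLaw (compProd (margSnd v) K)] 1 R₁ 0
      (max 0 (mutualInfo (outputSnd (fun x => margFst (K x)) v) - ε),
        max 0 (mutualInfo (outputSnd (fun x => margFst (K x)) v)
          + mutualInfo (outputSnd (fun x => margSnd (K x)) v) - 2 * ε)) := by
  have hQ := indepLaw_mem_stdSimplex (compProd_mem_stdSimplex (margSnd_mem_stdSimplex hv) hK)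
  obtain ⟨C₀, C₁, hcode⟩ := exists_code hv hK hε
  set law := ![compProd (margSnd v) K, indepLaw (compProd (margSnd v) K)] with hlaw
  set I₁ := mutualInfo (outputSnd (fun x => margFst (K x)) v)
  set I₂ := mutualInfo (outputSnd (fun x => margSnd (K x)) v)
  set a := mutualInfo v + ε with ha
  have hWpos : ∀ n : ℕ, 0 < ⌊Real.exp (n * R₁)⌋₊ := fun n =>
    Nat.floor_pos.2 (Real.one_le_exp (by positivity))
  have hex : ∀ n : ℕ, ∃ c : Code X Y₁ Y₂ n, 0 < n →
      c.W₁ = ⌊Real.exp (n * R₁)⌋₊ ∧ c.W₂ = 2 ∧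
      c.alpha₁ law 1 ≤ (√n)⁻¹ + C₀ / n + C₁ / n / (√n)⁻¹
        + Real.exp (-(⌊Real.exp (n * R₁)⌋₊ * Real.exp (-(n * a)))) ∧
      c.alpha₂ law ≤ (√n)⁻¹ + C₀ / n + C₁ / n / (√n)⁻¹
        + Real.exp (-(⌊Real.exp (n * R₁)⌋₊ * Real.exp (-(n * a)))) ∧
      c.beta₁ law 1 ≤ Real.exp (-(n * (I₁ - ε))) ∧
      c.beta₂ law ≤ Real.exp (-(n * (I₁ - ε))) * Real.exp (-(n * (I₂ - ε))) := by
    intro n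
    -- blocklength `0` is irrelevant for the limits, and any code will do
    rcases Nat.eq_zero_or_pos n with rfl | hn
    · exact ⟨⟨1, 1, fun _ => 0, fun _ _ => 0, fun _ _ => 0, fun _ _ _ => 0⟩,
        fun h => absurd h (lt_irrefl 0)⟩
    · have hn0 : (0 : ℝ) < n := by exact_mod_cast hn
      -- with `δ = 1 / √n` both `δ` and `C₁ / n / δ` vanish in the limit
      obtain ⟨c, hc⟩ := hcode n hn _ (hWpos n) (√n)⁻¹ (inv_pos.2 (Real.sqrt_pos.2 hn0))
      exact ⟨c, fun _ => hc⟩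
  choose c hc using hex
  set b : ℕ → ℝ := fun n => (√n)⁻¹ + C₀ / n + C₁ * (√n)⁻¹
    + Real.exp (-(Real.exp (n * (R₁ - a)) / 2)) with hb
  have hblim : Tendsto b atTop (𝓝 0) := by
    have l1 : Tendsto (fun n : ℕ => (√(n : ℝ))⁻¹) atTop (𝓝 0) :=
      tendsto_inv_atTop_zero.comp (Real.tendsto_sqrt_atTop.comp tendsto_natCast_atTop_atTop)
    have l2 : Tendsto (fun n : ℕ => C₀ / (n : ℝ)) atTop (𝓝 0) :=
      tendsto_const_nhds.div_atTop tendsto_natCast_atTop_atTop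
    have l3 : Tendsto (fun n : ℕ => (n : ℝ) * (R₁ - a)) atTop atTop :=
      tendsto_natCast_atTop_atTop.atTop_mul_const (by linarith)
    have l4 : Tendsto (fun n : ℕ => Real.exp (-(Real.exp (n * (R₁ - a)) / 2))) atTop (𝓝 0) :=
      Real.tendsto_exp_neg_atTop_nhds_zero.comp
        ((Real.tendsto_exp_atTop.comp l3).atTop_div_const two_pos)
    simpa using ((l1.add l2).add (l1.const_mul C₁)).add l4
  have hbound : ∀ n : ℕ, 0 < n → (√n)⁻¹ + C₀ / n + C₁ / n / (√n)⁻¹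
      + Real.exp (-(⌊Real.exp (n * R₁)⌋₊ * Real.exp (-(n * a)))) ≤ b n := by
    intro n hn
    have hn0 : (0 : ℝ) < n := by exact_mod_cast hn
    have e1 : C₁ / n / (√n)⁻¹ = C₁ * (√n)⁻¹ := by
      have hs : (√(n : ℝ)) ≠ 0 := (Real.sqrt_pos.2 hn0).ne'
      rw [div_inv_eq_mul, div_mul_eq_mul_div, div_eq_iff hn0.ne', mul_assoc]
      congr 1
      rw [eq_inv_mul_iff_mul_eq₀ hs, Real.mul_self_sqrt hn0.le]
    have e2 := half_exp_le_floor (a := a) hR₁.le n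
    have e3 := Real.exp_le_exp.2 (neg_le_neg e2)
    rw [e1]
    simp only [hb]
    linarith
  refine ⟨le_max_left _ _, le_max_left _ _, c, ?_, ?_, ?_, ?_, ?_, ?_⟩
  · refine limsup_coe_le_zero ?_ hblim
    filter_upwards [eventually_gt_atTop 0] with n hn
    exact (hc n hn).2.2.1.trans (hbound n hn)
  · refine limsup_coe_le_zero ?_ hblim
    filter_upwards [eventually_gt_atTop 0] with n hn
    exact (hc n hn).2.2.2.1.trans (hbound n hn)
  · refine le_errorExponent fun n hn => ?_
    rcases max_choice 0 (I₁ - ε) with h | h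
    · simp only [h, mul_zero, neg_zero, Real.exp_zero]
      exact probGuess_le_one hQ _ _
    · simp only [h]
      exact (hc n hn).2.2.2.2.1
  · refine le_errorExponent fun n hn => ?_
    rcases max_choice 0 (I₁ + I₂ - 2 * ε) with h | h
    · simp only [h, mul_zero, neg_zero, Real.exp_zero]
      exact probGuess_le_one hQ _ _
    · simp only [h]
      refine (hc n hn).2.2.2.2.2.trans (le_of_eq ?_)
      rw [← Real.exp_add]
      congr 1
      ring
  · refine limsup_le_of_le (by isBoundedDefault) ?_
    filter_upwards [eventually_gt_atTop 0] with n hn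
    have hn0 : (0 : ℝ) < n := by exact_mod_cast hn
    rw [(hc n hn).1]
    have hfl : (0 : ℝ) < ⌊Real.exp (n * R₁)⌋₊ := by exact_mod_cast hWpos n
    have h1 : Real.log ⌊Real.exp (n * R₁)⌋₊ ≤ n * R₁ :=
      (Real.log_le_log hfl (Nat.floor_le (Real.exp_pos _).le)).trans_eq (Real.log_exp _)
    have h2 : (n : ℝ)⁻¹ * Real.log ⌊Real.exp (n * R₁)⌋₊ ≤ R₁ := by
      rwa [inv_mul_le_iff₀ hn0]
    exact_mod_cast h2
  · refine (limsup_coe_le_zero (b := fun n : ℕ => (n : ℝ)⁻¹ * Real.log 2) ?_ ?_).trans_eq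
      EReal.coe_zero.symm
    · filter_upwards [eventually_gt_atTop 0] with n hn
      rw [(hc n hn).2.1]
      norm_num
    · simpa using (tendsto_inv_atTop_zero.comp tendsto_natCast_atTop_atTop).mul_const (Real.log 2)

theorem infoTriple_eq_mutualInfo {v : U × X → ℝ} (hv : ∀ a, 0 ≤ v a) {K₁ : X → Y₁ → ℝ}
    (hK₁ : ∀ x, K₁ x ∈ stdSimplex ℝ Y₁) {K₂ : X → Y₂ → ℝ} (hK₂ : ∀ x, K₂ x ∈ stdSimplex ℝ Y₂) :
    infoTriple (margSnd v) K₁ K₂ v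
      = (mutualInfo v, mutualInfo (outputSnd K₁ v), mutualInfo (outputSnd K₂ v)) := by
  rw [infoTriple, mutualInfo_eq_ent hv, mutualInfo_eq_ent (outputSnd_nonneg (fun x => (hK₁ x).1) hv),
    mutualInfo_eq_ent (outputSnd_nonneg (fun x => (hK₂ x).1) hv),
    margFst_outputSnd fun x => (hK₁ x).2, margFst_outputSnd fun x => (hK₂ x).2, margSnd_outputSnd,
    margSnd_outputSnd]

/-- Achievability: scaling an information triple towards `0` makes room in the rate constraint, and
the closure absorbs the loss. -/
theorem mem_exponentsRegion_of_mem_infoSet {w : X → ℝ} {K : X → Y₁ × Y₂ → ℝ}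
    (hw : w ∈ stdSimplex ℝ X) (hK : ∀ x, K x ∈ stdSimplex ℝ (Y₁ × Y₂)) {R₁ : ℝ} (hR₁ : 0 < R₁)
    {θ : ℝ × ℝ} (h₁ : 0 ≤ θ.1) (h₂ : 0 ≤ θ.2) {t : ℝ × ℝ × ℝ}
    (ht : t ∈ infoSet w (fun x => margFst (K x)) (fun x => margSnd (K x)))
    (hR : t.1 ≤ R₁) (hθ₁ : θ.1 ≤ t.2.1) (hθ₂ : θ.2 ≤ t.2.1 + t.2.2) :
    θ ∈ exponentsRegion ![compProd w K, indepLaw (compProd w K)] 1 R₁ 0 := by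
  have hK₁ : ∀ x, margFst (K x) ∈ stdSimplex ℝ Y₁ := fun x => margFst_mem_stdSimplex (hK x)
  have hK₂ : ∀ x, margSnd (K x) ∈ stdSimplex ℝ Y₂ := fun x => margSnd_mem_stdSimplex (hK x)
  -- the achievable pairs at the scale `1 - e`, with slack at most `e`
  have key : ∀ e : ℝ, 0 < e → e < 1 → ∃ ε : ℝ, 0 < ε ∧ ε ≤ e ∧
      Achievable ![compProd w K, indepLaw (compProd w K)] 1 R₁ 0
        (max 0 ((1 - e) * θ.1 - ε), max 0 ((1 - e) * θ.2 - 2 * ε)) := by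
    intro e he he1
    have hlt : (1 - e) * t.1 < R₁ := by
      rcases le_or_gt t.1 0 with h0 | h0
      · exact (mul_nonpos_of_nonneg_of_nonpos (by linarith) h0).trans_lt hR₁
      · nlinarith
    have hmem := convex_infoSet ht (zero_mem_infoSet hw) (by linarith : 0 ≤ 1 - e) he.le
      (by ring)
    rw [smul_zero, add_zero] at hmem
    obtain ⟨U, _, v, hv, rfl, hvt⟩ := exists_infoTriple_eq hK₁ hK₂ hmem
    rw [infoTriple_eq_mutualInfo hv.1 hK₁ hK₂] at hvt
    have v0 : mutualInfo v = (1 - e) * t.1 := congrArg (fun x => x.1) hvt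
    have v1 : mutualInfo (outputSnd (fun x => margFst (K x)) v) = (1 - e) * t.2.1 :=
      congrArg (fun x => x.2.1) hvt
    have v2 : mutualInfo (outputSnd (fun x => margSnd (K x)) v) = (1 - e) * t.2.2 :=
      congrArg (fun x => x.2.2) hvt
    have hpos : 0 < min e ((R₁ - (1 - e) * t.1) / 2) := lt_min he (by linarith)
    have hle := min_le_right e ((R₁ - (1 - e) * t.1) / 2)
    obtain ⟨-, -, c, hα₁, hα₂, hβ₁, hβ₂, hW⟩ := achievable_of_mutualInfo_lt hv hK hR₁ hpos
      (by rw [v0]; linarith)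
    have m1 := mul_le_mul_of_nonneg_left hθ₁ (by linarith : 0 ≤ 1 - e)
    have m2 := mul_le_mul_of_nonneg_left hθ₂ (by linarith : 0 ≤ 1 - e)
    refine ⟨_, hpos, min_le_left _ _, le_max_left _ _, le_max_left _ _, c, hα₁, hα₂,
      le_trans ?_ hβ₁, le_trans ?_ hβ₂, hW⟩
    · refine EReal.coe_le_coe_iff.2 (max_le_max le_rfl ?_)
      rw [v1]
      linarith
    · refine EReal.coe_le_coe_iff.2 (max_le_max le_rfl ?_)
      rw [v1, v2]
      linarith
  have he : ∀ k : ℕ, (0 : ℝ) < 1 / ((k : ℝ) + 2) ∧ (1 : ℝ) / ((k : ℝ) + 2) < 1 := fun k => by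
    have : (0 : ℝ) ≤ k := k.cast_nonneg
    exact ⟨by positivity, by rw [div_lt_one (by positivity)]; linarith⟩
  have le : Tendsto (fun k : ℕ => (1 : ℝ) / ((k : ℝ) + 2)) atTop (𝓝 0) :=
    tendsto_const_nhds.div_atTop (tendsto_natCast_atTop_atTop.atTop_add tendsto_const_nhds)
  choose ε hε hεe hach using fun k => key _ (he k).1 (he k).2
  have lε : Tendsto ε atTop (𝓝 0) := squeeze_zero (fun k => (hε k).le) hεe le
  refine mem_closure_of_tendsto (b := atTop) ?_ (Eventually.of_forall hach)
  have l1 : Tendsto (fun k : ℕ => max 0 ((1 - 1 / ((k : ℝ) + 2)) * θ.1 - ε k)) atTop (𝓝 θ.1) := by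
    have := (tendsto_const_nhds (x := (0 : ℝ))).max
      ((((tendsto_const_nhds (x := (1 : ℝ))).sub le).mul_const θ.1).sub lε)
    simpa [max_eq_right h₁] using this
  have l2 : Tendsto (fun k : ℕ => max 0 ((1 - 1 / ((k : ℝ) + 2)) * θ.2 - 2 * ε k)) atTop
      (𝓝 θ.2) := by
    have := (tendsto_const_nhds (x := (0 : ℝ))).max
      ((((tendsto_const_nhds (x := (1 : ℝ))).sub le).mul_const θ.2).sub (lε.const_mul 2))
    simpa [max_eq_right h₂] using this
  exact l1.prodMk_nhds l2

end Achievability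

/-! ### Test channels as Markov joint laws -/

section Markov

variable {U X Y₁ Y₂ : Type*} [Fintype U] [Fintype X] [Fintype Y₁] [Fintype Y₂]

omit [Fintype X] in
/-- A Markov joint law of `(U, X, Y₁, Y₂)` is determined by the law of `(U, X)` and the channel. -/
theorem eq_mul_of_isMarkov {w : X → ℝ} {K : X → Y₁ × Y₂ → ℝ} (hK : ∀ x, K x ∈ stdSimplex ℝ (Y₁ × Y₂))
    {q : U × X × Y₁ × Y₂ → ℝ} (hq : ∀ a, 0 ≤ q a) (hqP : margSnd q = compProd w K)
    (hM : IsMarkov q) (u : U) (x : X) (y : Y₁ × Y₂) :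
    q (u, x, y) = margFstMid q (u, x) * K x y := by
  have h := hM u x y
  rw [hqP, margFst_compProd fun x => (hK x).2] at h
  by_cases hx : w x = 0
  · have h0 : ∀ y, q (u, x, y) = 0 := fun y =>
      eq_zero_of_margSnd_eq_zero hq (b := (x, y)) (by rw [hqP, compProd, hx, zero_mul]) u
    simp [margFstMid, h0]
  · refine mul_right_cancel₀ hx (h.trans ?_)
    simp only [compProd]
    ring

/-- The joint law with `(U, X)` distributed as `v` and `(Y₁, Y₂)` produced from `X` by `K`. -/
def markovLaw (v : U × X → ℝ) (K : X → Y₁ × Y₂ → ℝ) (a : U × X × Y₁ × Y₂) : ℝ :=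
  v (a.1, a.2.1) * K a.2.1 a.2.2

variable {v : U × X → ℝ} {K : X → Y₁ × Y₂ → ℝ}

omit [Fintype U] [Fintype X] in
theorem margFstMid_markovLaw (hK : ∀ x, K x ∈ stdSimplex ℝ (Y₁ × Y₂)) :
    margFstMid (markovLaw v K) = v := by
  funext ⟨u, x⟩
  simp only [margFstMid, markovLaw, ← Finset.mul_sum, (hK x).2, mul_one]

omit [Fintype X] [Fintype Y₁] [Fintype Y₂] in
theorem margSnd_markovLaw : margSnd (markovLaw v K) = compProd (margSnd v) K := by
  funext ⟨x, y⟩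
  simp only [margSnd, markovLaw, compProd, Finset.sum_mul]

omit [Fintype U] [Fintype Y₁] in
theorem margFstThird_markovLaw :
    margFstThird (markovLaw v K) = outputSnd (fun x => margFst (K x)) v := by
  funext ⟨u, y⟩
  simp only [margFstThird, markovLaw, outputSnd, margFst, Finset.mul_sum]

omit [Fintype U] [Fintype Y₂] in
theorem margFstFourth_markovLaw :
    margFstFourth (markovLaw v K) = outputSnd (fun x => margSnd (K x)) v := by
  funext ⟨u, y⟩
  simp only [margFstFourth, markovLaw, outputSnd, margSnd, Finset.mul_sum]

theorem markovLaw_mem_stdSimplex (hv : v ∈ stdSimplex ℝ (U × X))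
    (hK : ∀ x, K x ∈ stdSimplex ℝ (Y₁ × Y₂)) :
    markovLaw v K ∈ stdSimplex ℝ (U × X × Y₁ × Y₂) := by
  refine ⟨fun a => mul_nonneg (hv.1 _) ((hK _).1 _), ?_⟩
  rw [← sum_margSnd, margSnd_markovLaw]
  exact (compProd_mem_stdSimplex (margSnd_mem_stdSimplex hv) hK).2

omit [Fintype X] in
theorem isMarkov_markovLaw (hK : ∀ x, K x ∈ stdSimplex ℝ (Y₁ × Y₂)) :
    IsMarkov (markovLaw v K) := by
  intro u x y
  rw [margFstMid_markovLaw hK, margSnd_markovLaw, margFst_compProd fun x => (hK x).2]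
  simp only [markovLaw, compProd]
  ring

end Markov
end HypTest

theorem mainTheorem2 {X Y₁ Y₂ : Type*} [Fintype X] [Fintype Y₁] [Fintype Y₂]
    (P Pbar : X × Y₁ × Y₂ → ℝ) (hP : P ∈ stdSimplex ℝ (X × Y₁ × Y₂))
    (hindep : ∀ y₁ y₂, HypTest.margSnd P (y₁, y₂)
      = HypTest.margFst (HypTest.margSnd P) y₁ * HypTest.margSnd (HypTest.margSnd P) y₂)
    (hPbar : ∀ x y₁ y₂, Pbar (x, y₁, y₂)
      = HypTest.margFst P x * HypTest.margFst (HypTest.margSnd P) y₁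
        * HypTest.margSnd (HypTest.margSnd P) y₂)
    (R₁ : ℝ) (hR₁ : 0 < R₁) :
    HypTest.exponentsRegion ![P, Pbar] 1 R₁ 0 =
      {θ : ℝ × ℝ | 0 ≤ θ.1 ∧ 0 ≤ θ.2 ∧
        ∃ (U : Type) (_ : Fintype U) (q : U × X × Y₁ × Y₂ → ℝ),
          q ∈ stdSimplex ℝ (U × X × Y₁ × Y₂) ∧
          HypTest.margSnd q = P ∧
          HypTest.IsMarkov q ∧
          HypTest.mutualInfo (HypTest.margFstMid q) ≤ R₁ ∧
          θ.1 ≤ HypTest.mutualInfo (HypTest.margFstThird q) ∧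
          θ.2 ≤ HypTest.mutualInfo (HypTest.margFstThird q)
            + HypTest.mutualInfo (HypTest.margFstFourth q)} := by
  open HypTest in
  obtain ⟨K, hK, hPK⟩ := exists_eq_compProd hP.1 (margSnd_mem_stdSimplex hP)
  have hw := margFst_mem_stdSimplex hP
  have hK₁ : ∀ x, margFst (K x) ∈ stdSimplex ℝ Y₁ := fun x => margFst_mem_stdSimplex (hK x)
  have hK₂ : ∀ x, margSnd (K x) ∈ stdSimplex ℝ Y₂ := fun x => margSnd_mem_stdSimplex (hK x)
  have hbar : Pbar = indepLaw P := funext fun a => hPbar a.1 a.2.1 a.2.2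
  rw [hbar]
  generalize margFst P = w at hPK hw
  subst hPK
  ext θ
  constructor
  · intro hθ
    obtain ⟨h1, h2, t, ht, hR, ht1, ht2⟩ := exists_mem_infoSet_of_mem_exponentsRegion hw hK hθ
    obtain ⟨U, _, v, hv, rfl, rfl⟩ := exists_infoTriple_eq hK₁ hK₂ ht
    rw [infoTriple_eq_mutualInfo hv.1 hK₁ hK₂] at hR ht1 ht2
    refine ⟨h1, h2, U, inferInstance, markovLaw v K, markovLaw_mem_stdSimplex hv hK,
      margSnd_markovLaw, isMarkov_markovLaw hK, ?_, ?_, ?_⟩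
    · rwa [margFstMid_markovLaw hK]
    · rwa [margFstThird_markovLaw]
    · rwa [margFstThird_markovLaw, margFstFourth_markovLaw]
  · rintro ⟨h1, h2, U, _, q, hq, hqP, hM, hR, ht1, ht2⟩
    have hqv : q = markovLaw (margFstMid q) K :=
      funext fun a => eq_mul_of_isMarkov hK hq.1 hqP hM a.1 a.2.1 a.2.2
    have hv : ∀ a, 0 ≤ margFstMid q a := fun a => Finset.sum_nonneg fun _ _ => hq.1 _
    have hvw : margSnd (margFstMid q) = w := by
      have h := congrArg margFst hqP
      rwa [hqv, margSnd_markovLaw, margFst_compProd fun x => (hK x).2,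
        margFst_compProd fun x => (hK x).2] at h
    have ht := infoTriple_mem_infoSet hw hK₁ hK₂ hv hvw
    rw [← hvw, infoTriple_eq_mutualInfo hv hK₁ hK₂, hvw] at ht
    rw [hqv, margFstThird_markovLaw] at ht1
    rw [hqv, margFstThird_markovLaw, margFstFourth_markovLaw] at ht2
    exact mem_exponentsRegion_of_mem_infoSet hw hK hR₁ h1 h2 ht hR ht1 ht2
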